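/- Let $n\ge 1$ and let $q_1,\dots,q_{n+2}\in\mathbb S^n\subset\mathbb R^{n+1}$ be spread evenly, i.e. they are the vertices of a regular simplex inscribed in $\mathbb S^n$ (equivalently $\langle q_i,q_j\rangle=-\frac1{n+1}$ for $i\ne j$). A function $u:\mathbb S^n\to\mathbb R$ is called $(n+2)$-symmetric if $u\circ\phi=u$ for every $\phi\in SO(n+1)$ that maps the set $\{q_1,\dots,q_{n+2}\}$ onto itself. For $p\in\mathbb R$ let $\mathcal B$ be the set of all positive $(n+2)$-symmetric functions $u$ on $\mathbb S^n$ that are support functions of convex bodies $\Omega_u\subset\mathbb R^{n+1}$ of finite volume and satisfy $\int_{\mathbb S^n}u^p=\alpha_n:=|\mathbb S^n|$. Let $I(u)=-(n+1)V(\Omega_u)$, where $V$ is the volume. For $u\in\mathcal B$ and a smooth $(n+2)$-symmetric function $\xi$ on $\mathbb S^n$, consider the normalized variation $$\varphi_\varepsilon=\frac{\alpha_n^{1/p}\,(u+\varepsilon\xi)}{\left(\int_{\mathbb S^n}(u+\varepsilon\xi)^p\right)^{1/p}}$$ and call $\xi$ admissible at $u$ if $\varphi_\varepsilon\in\mathcal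 B$ for all sufficiently small $|\varepsilon|$. The function $u$ is a critical point of $I$ on $\mathcal B$ if $\frac{d}{d\varepsilon}\big|_{\varepsilon=0}I(\varphi_\varepsilon)$ exists and equals $0$ for every admissible $\xi$. A critical point $u$ is unstable if, for some admissible $\xi$, the second variation $\frac{d^2}{d\varepsilon^2}\big|_{\varepsilon=0}I(\varphi_\varepsilon)$ exists and is negative. Theorem 7.1. Let $p<-2n-5$. Then every smooth $(n+2)$-symmetric $\xi$ is admissible at the constant function $u\equiv1$, and $u\equiv1$ is a critical point of $I$ on $\mathcal B$ which is unstable. Consequently $u\equiv1$ does not minimize $I$ on $\mathcal B$; indeed, there is a smooth $v\in\mathcal B$ with $I(v)<I(1)$. -/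

import Mathlib

open MeasureTheory Metric Set Filter Topology
open scoped Manifold ContDiff RealInnerProductSpace

/-- The ambient Euclidean space `ℝⁿ⁺¹`. -/
abbrev Amb (n : ℕ) : Type := EuclideanSpace ℝ (Fin (n + 1))

/-- The unit sphere `𝕊ⁿ ⊆ ℝⁿ⁺¹`. -/
abbrev Sph (n : ℕ) : Type := sphere (0 : Amb n) 1

noncomputable section

/-- The standard surface measure on `𝕊ⁿ`. -/
def surf (n : ℕ) : Measure (Sph n) := (volume : Measure (Amb n)).toSphere

/-- Real-valued `C^∞` functions on the sphere. -/
def IsSmooth {n : ℕ} (u : Sph n → ℝ) : Prop := ContMDiff (𝓡 n) 𝓘(ℝ, ℝ) ∞ u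

/-- `n + 2` points spread evenly on `𝕊ⁿ`: the vertices of an inscribed regular simplex. Any `n + 2`
distinct, pairwise equidistant points of `𝕊ⁿ` have pairwise inner products `-1 / (n + 1)`. -/
def SpreadEvenly {n : ℕ} (q : Fin (n + 2) → Sph n) : Prop :=
  ∀ i j, i ≠ j → ⟪(q i : Amb n), (q j : Amb n)⟫ = -1 / ((n : ℝ) + 1)

/-- The action of a linear isometry of `ℝⁿ⁺¹` on the sphere. -/
def rotate {n : ℕ} (φ : Amb n ≃ₗᵢ[ℝ] Amb n) (x : Sph n) : Sph n :=
  ⟨φ x, by simp⟩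

/-- The rotations `φ ∈ SO(n + 1)` which map the set `{q₁, …, q_{n+2}}` onto itself. -/
def rotationsOf {n : ℕ} (q : Fin (n + 2) → Sph n) : Set (Amb n ≃ₗᵢ[ℝ] Amb n) :=
  {φ | LinearMap.det (φ.toLinearEquiv : Amb n →ₗ[ℝ] Amb n) = 1 ∧ rotate φ '' range q = range q}

/-- `(n + 2)`-symmetry of a function on the sphere. -/
def IsSymmetric {n : ℕ} (q : Fin (n + 2) → Sph n) (u : Sph n → ℝ) : Prop :=
  ∀ φ ∈ rotationsOf q, ∀ x, u (rotate φ x) = u x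

/-- The support function of a convex body, `x ↦ max_{y ∈ K} ⟨x, y⟩`. -/
def supportFn {n : ℕ} (K : ConvexBody (Amb n)) (x : Sph n) : ℝ :=
  sSup ((fun y : Amb n => ⟪(x : Amb n), y⟫) '' (K : Set (Amb n)))

/-- The body `Ω_u` determined by a support function `u`. -/
def body {n : ℕ} (u : Sph n → ℝ) : Set (Amb n) :=
  {y | ∀ x : Sph n, ⟪(x : Amb n), y⟫ ≤ u x}

/-- If `u` is the support function of the convex body `K`, then `Ω_u = K`. -/
theorem body_supportFn {n : ℕ} (K : ConvexBody (Amb n)) : body (supportFn K) = K := by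
  have hbdd : ∀ x : Sph n,
      BddAbove ((fun y : Amb n => ⟪(x : Amb n), y⟫) '' (K : Set (Amb n))) := fun x =>
    (K.isCompact.image (by fun_prop)).bddAbove
  apply Subset.antisymm
  · intro y hy
    by_contra hyK
    obtain ⟨f, s, hfs, hsy⟩ :=
      geometric_hahn_banach_closed_point K.convex K.isCompact.isClosed hyK
    set v : Amb n := (InnerProductSpace.toDual ℝ (Amb n)).symm f with hv
    have hf : ∀ z, f z = ⟪v, z⟫ := fun z => by simp [hv]
    obtain ⟨k, hk⟩ := K.nonempty
    have hv0 : v ≠ 0 := by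
      intro h
      have h1 := hfs k hk
      rw [hf, h, inner_zero_left] at h1
      rw [hf, h, inner_zero_left] at hsy
      linarith
    have hpos : 0 < ‖v‖ := norm_pos_iff.2 hv0
    let x : Sph n := ⟨‖v‖⁻¹ • v, by simp [norm_smul, hpos.ne']⟩
    have hx : ∀ z, ⟪(x : Amb n), z⟫ = ‖v‖⁻¹ * f z := fun z => by
      rw [hf]; exact real_inner_smul_left _ _ _
    have h1 : supportFn K x ≤ ‖v‖⁻¹ * s := by
      apply csSup_le (K.nonempty.image _)
      rintro _ ⟨z, hz, rfl⟩
      simp only [hx]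
      exact mul_le_mul_of_nonneg_left (hfs z hz).le (by positivity)
    have h2 := hy x
    rw [hx] at h2
    have h3 : ‖v‖⁻¹ * s < ‖v‖⁻¹ * f y := mul_lt_mul_of_pos_left hsy (by positivity)
    linarith
  · intro y hy x
    exact le_csSup (hbdd x) ⟨y, hy, rfl⟩

/-- The class `ℬ`: positive support functions of convex bodies of finite volume, `(n + 2)`-symmetric
and normalized by `∫ u ^ p = |𝕊ⁿ|`. -/
def classB {n : ℕ} (p : ℝ) (q : Fin (n + 2) → Sph n) : Set (Sph n → ℝ) :=
  {u | (∃ K : ConvexBody (Amb n), u = supportFn K) ∧ (∀ x, 0 < u x) ∧ volume (body u) < ⊤ ∧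
    IsSymmetric q u ∧ ∫ x, u x ^ p ∂(surf n) = (surf n).real univ}

/-- The functional `I(u) = -(n + 1) V(Ω_u)`, with `V` the `(n + 1)`-dimensional volume. -/
def energy {n : ℕ} (u : Sph n → ℝ) : ℝ :=
  -((n : ℝ) + 1) * volume.real (body u)

/-- The normalized variation
`φ_ε = |𝕊ⁿ|^(1/p) (u + ε ξ) / (∫ (u + ε ξ) ^ p) ^ (1/p)` of `u` in the direction `ξ`. -/
def variation {n : ℕ} (p : ℝ) (u ξ : Sph n → ℝ) (ε : ℝ) : Sph n → ℝ := fun x =>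
  (surf n).real univ ^ (1 / p) * (u x + ε * ξ x) /
    (∫ y, (u y + ε * ξ y) ^ p ∂(surf n)) ^ (1 / p)

/-- Smooth `(n + 2)`-symmetric directions along which the normalized variation stays in `ℬ`. -/
def IsAdmissible {n : ℕ} (p : ℝ) (q : Fin (n + 2) → Sph n) (u ξ : Sph n → ℝ) : Prop :=
  IsSmooth ξ ∧ IsSymmetric q ξ ∧ ∀ᶠ ε in 𝓝 (0 : ℝ), variation p u ξ ε ∈ classB p q

/-- `u` is a critical point of the functional on `ℬ`: it lies in `ℬ`, and the first variation
exists and vanishes in every admissible direction. -/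
def IsCriticalPoint {n : ℕ} (p : ℝ) (q : Fin (n + 2) → Sph n) (u : Sph n → ℝ) : Prop :=
  u ∈ classB p q ∧ ∀ ξ, IsAdmissible p q u ξ →
    HasDerivAt (fun ε => energy (variation p u ξ ε)) 0 0

/-- The second variation `d²/dε² I(φ_ε)` at `ε = 0` in the direction `ξ` exists and equals `s`. -/
def HasSecondVariation {n : ℕ} (p : ℝ) (u ξ : Sph n → ℝ) (s : ℝ) : Prop :=
  ∃ g : ℝ → ℝ, (∀ᶠ ε in 𝓝 (0 : ℝ), HasDerivAt (fun t => energy (variation p u ξ t)) (g ε) ε) ∧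
    HasDerivAt g s 0

/-- `u` is unstable: the second variation is negative in some admissible direction. -/
def IsUnstable {n : ℕ} (p : ℝ) (q : Fin (n + 2) → Sph n) (u : Sph n → ℝ) : Prop :=
  ∃ ξ, IsAdmissible p q u ξ ∧ ∃ s < 0, HasSecondVariation p u ξ s

end

/-! The normalized variation of the constant `1` is a positive multiple of `1 + ε ξ`, so by
homogeneity of volume its energy is `-(n+1) (J/α)^(-(n+1)/p) V`. Here `J = ∫ (1 + ε ξ)^p`, `α` is
the area of the sphere, and `V` is the volume of the body with support function `1 + ε ξ`. The
factor `J` is differentiated under the integral; the work lies in `V`.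

Extend `ξ` to a smooth ambient `f`, and let `G` be the field equal on the sphere to the gradient of
the 1-homogeneous extension of `ξ`. For small `ε` the map `y ↦ y + ε G(y)` carries the unit ball
onto the body (`eventually_image_eq_body`), so `V` is the integral of a Jacobian determinant, hence
a polynomial in `ε` (`exists_polynomial_volume_body`). This settles differentiability without
computing any Hessian.

The coefficients come from a separate one-sided estimate. The radial function is at least `1 + ε f -
ε² |∇f|²/2 - K |ε|³`, with `∇` the tangential gradient, and polar coordinates turn this into a lower
bound for `V`. A polynomial above such a bound with equality at `0` has the same linear coefficient
and at least the same quadratic one (`Polynomial.coeff_of_eventually_le`). Only this inequality is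
needed, because the energy is minus the volume.

The linear terms of `J` and `V` cancel, so `1` is critical. For mean-zero `ξ` the second variation
is at most `-(n+1) ∫ ((n - p + 1) ξ² - |∇ξ|²)`. The direction used is `∑ ⟨q i, x⟩³`: it is
symmetric, odd, and harmonic because `∑ q i = 0`. Its Dirichlet energy is `3(n+2) ∫ ξ²`
(`integral_norm_tangentialGradient_cubic_sq`), which leaves the factor `-2n - 5 - p > 0`. A strict
second-order decrease at a critical point then yields the competitor `v`. -/

open scoped Pointwise

/-! ### Smooth extension from the sphere to the ambient space -/

/-- A smooth function on the sphere is locally the restriction of a smooth ambient function. -/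
theorem IsSmooth.exists_contDiffOn {n : ℕ} {u : Sph n → ℝ} (hu : IsSmooth u) (x₀ : Sph n) :
    ∃ U ∈ 𝓝 (x₀ : Amb n), ∃ f : Amb n → ℝ, ContDiffOn ℝ ∞ f U ∧
      ∀ x : Sph n, (x : Amb n) ∈ U → f x = u x := by
  have := Fact.mk (@finrank_euclideanSpace_fin ℝ _ (n + 1))
  -- Projecting from the antipode puts `x₀` in the chart domain; the projection formula also makes
  -- sense off the sphere, wherever `⟪-x₀, y⟫ ≠ 1`, and so provides the local extension.
  let e := stereographic' n (-x₀)
  let R := (OrthonormalBasis.fromOrthogonalSpanSingleton (𝕜 := ℝ) n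
    (ne_zero_of_mem_unit_sphere (-x₀))).repr
  have h1 : ContDiff ℝ ∞ (u ∘ e.symm) := by
    have h := (contMDiff_iff.1 hu).2 x₀ 0
    rw [← contDiffOn_univ]
    convert! h using 1
    simp [chartAt, ChartedSpace.chartAt]
  have h2 : ContDiffOn ℝ ∞ (stereoToFun (((-x₀ : Sph n) : Amb n)))
      {x | innerSL ℝ (((-x₀ : Sph n) : Amb n)) x ≠ 1} := contDiffOn_stereoToFun
  have ho : IsOpen {x | innerSL ℝ (((-x₀ : Sph n) : Amb n)) x ≠ 1} :=
    isOpen_ne_fun (by fun_prop) continuous_const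
  refine ⟨_, ho.mem_nhds ?_, fun y => (u ∘ e.symm) (R (stereoToFun (((-x₀ : Sph n) : Amb n)) y)),
    (h1.comp R.contDiff).comp_contDiffOn h2, ?_⟩
  · simp; norm_num
  · intro x hx
    have hxe : x ∈ e.source := by
      simp only [e, stereographic'_source, mem_compl_iff, mem_singleton_iff]
      rintro rfl
      simp at hx
    have : e.symm (e x) = x := e.left_inv hxe
    change u (e.symm (e x)) = u x
    rw [this]

/-- Cutting off a smooth function away from the sphere. -/
theorem ContDiff.exists_hasCompactSupport_eventuallyEq {n : ℕ} {f : Amb n → ℝ}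
    (hf : ContDiff ℝ ∞ f) : ∃ f' : Amb n → ℝ, ContDiff ℝ ∞ f' ∧ HasCompactSupport f' ∧
      ∀ x : Sph n, f' =ᶠ[𝓝 (x : Amb n)] f := by
  let χ : ContDiffBump (0 : Amb n) := ⟨2, 3, by norm_num, by norm_num⟩
  refine ⟨fun y => χ y * f y, χ.contDiff.mul hf, χ.hasCompactSupport.mul_right, fun x => ?_⟩
  have hx : (x : Amb n) ∈ ball (0 : Amb n) χ.rIn := by simp [χ]
  filter_upwards [isOpen_ball.mem_nhds hx] with y hy
  rw [χ.one_of_mem_closedBall (ball_subset_closedBall hy), one_mul]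

/-- A smooth function on the sphere is the restriction of a smooth function with compact
support. -/
theorem IsSmooth.exists_contDiff_extension {n : ℕ} {u : Sph n → ℝ} (hu : IsSmooth u) :
    ∃ f : Amb n → ℝ, ContDiff ℝ ∞ f ∧ HasCompactSupport f ∧ ∀ x : Sph n, f x = u x := by
  -- The constraint fixes the value on the sphere and is vacuous elsewhere. It is convex, so a
  -- partition of unity glues the local extensions.
  let t : Amb n → Set ℝ := fun y => {r | ∀ x : Sph n, (x : Amb n) = y → r = u x}
  obtain ⟨f, hf⟩ := exists_contMDiffMap_forall_mem_convex_of_local (n := ⊤) 𝓘(ℝ, Amb n) (t := t)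
    (fun y a ha b hb s r hs hr hsr x hx => by
      simp only [smul_eq_mul]
      rw [ha x hx, hb x hx, ← add_mul, hsr, one_mul])
    (fun y => by
      by_cases hy : y ∈ sphere (0 : Amb n) 1
      · obtain ⟨U, hU, f, hf, hfu⟩ := hu.exists_contDiffOn ⟨y, hy⟩
        exact ⟨U, hU, f, hf.contMDiffOn, fun z hz x hx => by
          subst hx; exact hfu x hz⟩
      · refine ⟨(sphere (0 : Amb n) 1)ᶜ, isClosed_sphere.isOpen_compl.mem_nhds hy, fun _ => 0,
          contMDiffOn_const, fun z hz x hx => ?_⟩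
        exact absurd (hx ▸ x.2) hz)
  obtain ⟨f', hf', hc, he⟩ :=
    ContDiff.exists_hasCompactSupport_eventuallyEq (f := f) f.contMDiff.contDiff
  exact ⟨f', hf', hc, fun x => (he x).self_of_nhds.trans (hf x x rfl)⟩

theorem IsSmooth.of_contDiff {n : ℕ} {f : Amb n → ℝ} (hf : ContDiff ℝ ∞ f) :
    IsSmooth (fun x : Sph n => f x) := by
  have := Fact.mk (@finrank_euclideanSpace_fin ℝ _ (n + 1))
  exact hf.contMDiff.comp contMDiff_coe_sphere

theorem IsSmooth.continuous {n : ℕ} {u : Sph n → ℝ} (hu : IsSmooth u) : Continuous u :=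
  ContMDiff.continuous hu

/-! ### Tangential gradient and Taylor expansion on the sphere -/

noncomputable section

/-- The tangential part of the gradient of an ambient function at a point of the sphere. -/
def tangentialGradient {n : ℕ} (f : Amb n → ℝ) (x : Amb n) : Amb n :=
  gradient f x - ⟪gradient f x, x⟫ • x

/-- On the sphere this is the gradient of the `1`-homogeneous extension of `f`. -/
def supportField {n : ℕ} (f : Amb n → ℝ) (x : Amb n) : Amb n :=
  tangentialGradient f x + f x • x

end

section
variable {n : ℕ} {f : Amb n → ℝ}

theorem ContDiff.contDiff_gradient (hf : ContDiff ℝ ∞ f) : ContDiff ℝ ∞ (gradient f) :=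
  (InnerProductSpace.toDual ℝ (Amb n)).symm.contDiff.comp (hf.fderiv_right (by simp))

theorem contDiff_tangentialGradient (hf : ContDiff ℝ ∞ f) :
    ContDiff ℝ ∞ (tangentialGradient f) :=
  hf.contDiff_gradient.sub ((hf.contDiff_gradient.inner ℝ contDiff_id).smul contDiff_id)

theorem contDiff_supportField (hf : ContDiff ℝ ∞ f) : ContDiff ℝ ∞ (supportField f) :=
  (contDiff_tangentialGradient hf).add (hf.smul contDiff_id)

theorem hasCompactSupport_gradient (hc : HasCompactSupport f) :
    HasCompactSupport (gradient f) :=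
  (hc.fderiv (𝕜 := ℝ)).comp_left (g := (InnerProductSpace.toDual ℝ (Amb n)).symm) (by simp)

theorem hasCompactSupport_supportField (hc : HasCompactSupport f) :
    HasCompactSupport (supportField f) := by
  have hg := hasCompactSupport_gradient hc
  have h1 : HasCompactSupport (fun x => ⟪gradient f x, x⟫ • x) :=
    hg.mono fun x hx h => hx (by simp [h])
  have h2 : HasCompactSupport (fun x => f x • x) := hc.mono fun x hx h => hx (by simp [h])
  exact (hg.sub h1).add h2

theorem inner_tangentialGradient_self (f : Amb n → ℝ) (x : Sph n) :
    ⟪(x : Amb n), tangentialGradient f x⟫ = 0 := by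
  simp [tangentialGradient, inner_sub_right, inner_smul_right]

theorem norm_tangentialGradient_sq (f : Amb n → ℝ) (x : Sph n) :
    ‖tangentialGradient f x‖ ^ 2 = ‖gradient f (x : Amb n)‖ ^ 2 - ⟪gradient f (x : Amb n), x⟫ ^ 2 := by
  rw [tangentialGradient, norm_sub_sq_real, inner_smul_right, norm_smul]
  simp
  ring

/-- Trades angles for chords; the term `‖y - x‖² / 2` is the curvature of the sphere that absorbs
quadratic errors in the support estimates. -/
theorem inner_sphere_eq (x y : Sph n) :
    ⟪(x : Amb n), (y : Amb n)⟫ = 1 - ‖(y : Amb n) - x‖ ^ 2 / 2 := by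
  rw [norm_sub_sq_real, real_inner_comm]
  simp
  ring

/-- First order Taylor expansion on the sphere, with a uniform quadratic error. -/
theorem exists_tangential_taylor (hf : ContDiff ℝ ∞ f) (hc : HasCompactSupport f) :
    ∃ C, 0 ≤ C ∧ ∀ x y : Sph n,
      |f y - f x - ⟪tangentialGradient f x, (y : Amb n) - x⟫| ≤ C * ‖(y : Amb n) - x‖ ^ 2 := by
  obtain ⟨L, hL⟩ := ((hf.fderiv_right (m := ∞) (by simp)).of_le (m := 1) (by simp)
    ).lipschitzWith_of_hasCompactSupport (hc.fderiv (𝕜 := ℝ)) one_ne_zero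
  obtain ⟨M, hM⟩ := hf.contDiff_gradient.continuous.bounded_above_of_compact_support
    (hasCompactSupport_gradient hc)
  have hM0 : 0 ≤ M := (norm_nonneg _).trans (hM 0)
  refine ⟨L + M, by positivity, fun x y => ?_⟩
  have h1 : |f y - f x - fderiv ℝ f x ((y : Amb n) - x)| ≤
      L * ‖(y : Amb n) - x‖ * ‖(y : Amb n) - x‖ := by
    have := (convex_segment (x : Amb n) y).norm_image_sub_le_of_norm_hasFDerivWithin_le'
      (f := f) (f' := fderiv ℝ f) (φ := fderiv ℝ f x) (C := L * ‖(y : Amb n) - x‖)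
      (fun z _ => ((hf.differentiable (by simp)) z).hasFDerivAt.hasFDerivWithinAt)
      (fun z hz => by
        rw [← dist_eq_norm]
        refine (hL.dist_le_mul _ _).trans ?_
        gcongr
        rw [dist_eq_norm]
        exact norm_sub_le_of_mem_segment hz)
      (left_mem_segment ℝ _ _) (right_mem_segment ℝ _ _)
    simpa using this
  -- Since `⟪x, y - x⟫ = -‖y - x‖² / 2`, dropping the radial part of the gradient costs only a
  -- quadratic error.
  have h2 : ⟪tangentialGradient f x, (y : Amb n) - x⟫ =
      fderiv ℝ f x ((y : Amb n) - x) + ⟪gradient f (x : Amb n), x⟫ * (‖(y : Amb n) - x‖ ^ 2 / 2) := by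
    rw [tangentialGradient, inner_sub_left, inner_gradient_left, inner_smul_left,
      inner_sub_right, inner_sphere_eq]
    simp
  have h3 : |⟪gradient f (x : Amb n), x⟫| ≤ M := by
    refine (abs_real_inner_le_norm _ _).trans ?_
    simpa using hM x
  rw [h2]
  calc |f y - f x - (fderiv ℝ f x ((y : Amb n) - x) +
        ⟪gradient f (x : Amb n), x⟫ * (‖(y : Amb n) - x‖ ^ 2 / 2))|
      = |(f y - f x - fderiv ℝ f x ((y : Amb n) - x)) -
        ⟪gradient f (x : Amb n), x⟫ * (‖(y : Amb n) - x‖ ^ 2 / 2)| := by ring_nf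
    _ ≤ L * ‖(y : Amb n) - x‖ * ‖(y : Amb n) - x‖ + M * (‖(y : Amb n) - x‖ ^ 2 / 2) := by
      refine (abs_sub _ _).trans (add_le_add h1 ?_)
      rw [abs_mul, abs_of_nonneg (by positivity : 0 ≤ ‖(y : Amb n) - x‖ ^ 2 / 2)]
      gcongr
    _ ≤ (L + M) * ‖(y : Amb n) - x‖ ^ 2 := by nlinarith [sq_nonneg ‖(y : Amb n) - x‖]

end

/-! ### Bodies, support functions and the radial lower bound -/

section
variable {n : ℕ}

instance : Nonempty (Sph n) := (NormedSpace.sphere_nonempty.2 zero_le_one).to_subtype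

instance : IsFiniteMeasure (surf n) := by unfold surf; infer_instance

instance : (surf n).IsOpenPosMeasure := by unfold surf; infer_instance

theorem eventually_nhds_zero_lt {g : ℝ → ℝ} (hg : Continuous g) {a : ℝ} (h : g 0 < a) :
    ∀ᶠ ε in 𝓝 (0 : ℝ), g ε < a :=
  (hg.tendsto 0).eventually (gt_mem_nhds h)

theorem surf_real_univ : (surf n).real univ = ((n : ℝ) + 1) * volume.real (ball (0 : Amb n) 1) := by
  rw [surf, Measure.toSphere_real_apply_univ]
  simp

theorem surf_real_univ_pos : 0 < (surf n).real univ :=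
  ENNReal.toReal_pos (isOpen_univ.measure_pos _ univ_nonempty).ne' (measure_ne_top _ _)

theorem integrable_surf {F : Type*} [NormedAddCommGroup F] {u : Sph n → F} (hu : Continuous u) :
    Integrable u (surf n) :=
  hu.integrable_of_hasCompactSupport (HasCompactSupport.of_compactSpace u)

theorem exists_forall_abs_le {u : Sph n → ℝ} (hu : Continuous u) : ∃ M, 0 ≤ M ∧ ∀ x, |u x| ≤ M := by
  obtain ⟨M, hM⟩ := (isCompact_range hu.abs).bddAbove
  exact ⟨M, (abs_nonneg _).trans (hM ⟨Classical.arbitrary _, rfl⟩), fun x => hM ⟨x, rfl⟩⟩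

/-- A nonzero vector is a positive multiple of a point of the sphere. -/
theorem exists_eq_norm_smul {z : Amb n} (hz : z ≠ 0) : ∃ x : Sph n, z = ‖z‖ • (x : Amb n) :=
  ⟨⟨‖z‖⁻¹ • z, by simp [norm_smul, hz]⟩, by simp [smul_smul, hz]⟩

theorem norm_le_of_mem_body {h : Sph n → ℝ} {M : ℝ} (hM0 : 0 ≤ M) (hM : ∀ x, h x ≤ M) {z : Amb n}
    (hz : z ∈ body h) : ‖z‖ ≤ M := by
  rcases eq_or_ne z 0 with rfl | h0
  · simpa
  obtain ⟨x, hx⟩ := exists_eq_norm_smul h0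
  have h1 := hz x
  rw [hx, inner_smul_right] at h1
  simp at h1
  exact h1.trans (hM x)

theorem isClosed_body (h : Sph n → ℝ) : IsClosed (body h) := by
  simp only [body, ofPred_forall]
  exact isClosed_iInter fun x => isClosed_le (by fun_prop) continuous_const

theorem isCompact_body {h : Sph n → ℝ} (hh : Continuous h) : IsCompact (body h) := by
  obtain ⟨M, hM0, hM⟩ := exists_forall_abs_le hh
  exact (isCompact_closedBall (0 : Amb n) M).of_isClosed_subset (isClosed_body h) fun z hz =>
    by simpa using norm_le_of_mem_body hM0 (fun x => (le_abs_self _).trans (hM x)) hz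

theorem convex_body (h : Sph n → ℝ) : Convex ℝ (body h) := by
  intro a ha b hb s r hs hr hsr x
  have h1 := mul_le_mul_of_nonneg_left (ha x) hs
  have h2 := mul_le_mul_of_nonneg_left (hb x) hr
  rw [inner_add_right, inner_smul_right, inner_smul_right]
  calc s * ⟪(x : Amb n), a⟫ + r * ⟪(x : Amb n), b⟫ ≤ s * h x + r * h x := add_le_add h1 h2
    _ = h x := by rw [← add_mul, hsr, one_mul]

/-- A function all of whose half-spaces touch their intersection is a support function. -/
theorem exists_eq_supportFn {h : Sph n → ℝ} (hh : Continuous h)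
    (ht : ∀ x : Sph n, ∃ z : Amb n, ⟪(x : Amb n), z⟫ = h x ∧ ∀ y : Sph n, ⟪(y : Amb n), z⟫ ≤ h y) :
    ∃ K : ConvexBody (Amb n), h = supportFn K := by
  refine ⟨⟨body h, convex_body h, isCompact_body hh, ?_⟩, ?_⟩
  · obtain ⟨z, -, hz⟩ := ht (Classical.arbitrary _)
    exact ⟨z, hz⟩
  · ext x
    obtain ⟨z, hzx, hz⟩ := ht x
    have hg : IsGreatest ((fun y : Amb n => ⟪(x : Amb n), y⟫) '' body h) (h x) := by
      refine ⟨⟨z, hz, hzx⟩, ?_⟩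
      rintro _ ⟨y, hy, rfl⟩
      exact hy x
    exact hg.csSup_eq.symm

theorem body_smul {c : ℝ} (hc : 0 < c) (h : Sph n → ℝ) : body (fun x => c * h x) = c • body h := by
  ext z
  rw [mem_smul_set_iff_inv_smul_mem₀ hc.ne']
  simp only [body, mem_ofPred_eq, inner_smul_right]
  exact forall_congr' fun x => by rw [inv_mul_le_iff₀ hc]

theorem volume_body_smul {c : ℝ} (hc : 0 < c) (h : Sph n → ℝ) :
    volume.real (body (fun x => c * h x)) = c ^ (n + 1) * volume.real (body h) := by
  rw [body_smul hc, measureReal_def, Measure.addHaar_smul, ENNReal.toReal_mul, measureReal_def]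
  simp [abs_of_pos hc, hc.le]

theorem body_one : body (fun _ : Sph n => 1) = closedBall 0 1 := by
  ext z
  refine ⟨fun hz => by simpa using norm_le_of_mem_body zero_le_one (fun _ => le_rfl) hz,
    fun hz x => ?_⟩
  refine (real_inner_le_norm _ _).trans ?_
  simpa using hz

theorem volume_body_one : volume.real (body (fun _ : Sph n => 1)) =
    (surf n).real univ / ((n : ℝ) + 1) := by
  rw [body_one, surf_real_univ, measureReal_def, Measure.addHaar_closedBall_eq_addHaar_ball,
    ← measureReal_def]
  field_simp

variable {f : Amb n → ℝ}

/-- The tangential part of `supportField` is invisible in the direction `x`. Hence `x + ε G(x)` is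
the candidate contact point for the half-space with normal `x`. -/
theorem inner_supportField_self (f : Amb n → ℝ) (x : Sph n) (ε : ℝ) :
    ⟪(x : Amb n), (x : Amb n) + ε • supportField f x⟫ = 1 + ε * f x := by
  rw [inner_add_right, inner_smul_right, supportField, inner_add_right,
    inner_tangentialGradient_self, inner_smul_right]
  simp

/-- For small `ε` the point `x + ε G(x)` lies in all half-spaces determined by `1 + ε f`. -/
theorem eventually_inner_supportField_le (hf : ContDiff ℝ ∞ f) (hc : HasCompactSupport f) :
    ∀ᶠ ε in 𝓝 (0 : ℝ), ∀ x y : Sph n,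
      ⟪(y : Amb n), (x : Amb n) + ε • supportField f x⟫ ≤ 1 + ε * f y := by
  obtain ⟨C, hC0, hC⟩ := exists_tangential_taylor hf hc
  obtain ⟨M, hM0, hM⟩ := exists_forall_abs_le (n := n)
    (u := fun x => f x) (hf.continuous.comp continuous_subtype_val)
  have hsmall : ∀ᶠ ε in 𝓝 (0 : ℝ), |ε| * (M / 2 + C) < 1 / 2 :=
    eventually_nhds_zero_lt (by fun_prop) (by norm_num)
  filter_upwards [hsmall] with ε hε x y
  have h1 : ⟪(y : Amb n), (x : Amb n) + ε • supportField f x⟫ =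
      (1 + ε * f x) * (1 - ‖(y : Amb n) - x‖ ^ 2 / 2) +
        ε * ⟪tangentialGradient f x, (y : Amb n) - x⟫ := by
    rw [inner_sub_right, real_inner_comm (x : Amb n) (tangentialGradient f x),
      inner_tangentialGradient_self, ← inner_sphere_eq, supportField, inner_add_right,
      inner_smul_right, inner_add_right, inner_smul_right,
      real_inner_comm (y : Amb n) (tangentialGradient f x), real_inner_comm (x : Amb n) (y : Amb n)]
    ring
  rw [h1]
  have h2 := hC x y
  set d := ‖(y : Amb n) - x‖
  set T := f y - f x - ⟪tangentialGradient f x, (y : Amb n) - x⟫ with hT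
  have h3 : -(|ε| * (C * d ^ 2)) ≤ ε * T := by
    have : |ε * T| ≤ |ε| * (C * d ^ 2) := by rw [abs_mul]; gcongr
    exact (abs_le.1 this).1
  have h4 : -(|ε| * M) ≤ ε * f x := by
    have : |ε * f x| ≤ |ε| * M := by rw [abs_mul]; gcongr; exact hM x
    exact (abs_le.1 this).1
  -- The gap is `(1 + ε f x) d²/2 + ε T` with `|T| ≤ C d²`, so for small `ε` the curvature term
  -- dominates.
  nlinarith [sq_nonneg d, mul_le_mul_of_nonneg_right hε.le (sq_nonneg d),
    mul_le_mul_of_nonneg_right h4 (sq_nonneg d)]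

/-- Scalar form of the second order estimate for the radial function. -/
theorem quadratic_remainder_nonneg {e β t N K : ℝ} (he : 0 ≤ e) (hN : N * e ≤ 1 / 2)
    (hK : β ^ 2 * N ≤ K) (hK0 : 0 ≤ K) :
    0 ≤ e ^ 2 * β ^ 2 / 2 + K * e ^ 3 + (1 - N * e) * (t ^ 2 / 2) - e * β * t := by
  have ha : 0 < 1 - N * e := by linarith
  -- After this multiplication the square in `t` can be completed; the leftover cubic terms in `e`
  -- are nonnegative by `hK` and `hN`.
  refine (mul_nonneg_iff_of_pos_left (by linarith : 0 < 2 * (1 - N * e))).1 ?_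
  have h1 : 0 ≤ e ^ 3 * (K - β ^ 2 * N) := by
    apply mul_nonneg (by positivity); linarith
  have h2 : 0 ≤ K * e ^ 3 * (1 / 2 - N * e) := by
    apply mul_nonneg (by positivity); linarith
  nlinarith [sq_nonneg ((1 - N * e) * t - e * β)]

/-- A second order lower bound for the radial function of the body with support function
`1 + ε f`. -/
theorem eventually_radial_lower_bound (hf : ContDiff ℝ ∞ f) (hc : HasCompactSupport f) :
    ∃ K, 0 ≤ K ∧ ∀ᶠ ε in 𝓝 (0 : ℝ), ∀ x y : Sph n,
      (1 + ε * f x - ε ^ 2 * ‖tangentialGradient f x‖ ^ 2 / 2 - K * |ε| ^ 3) *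
        ⟪(y : Amb n), (x : Amb n)⟫ ≤ 1 + ε * f y := by
  obtain ⟨C, hC0, hC⟩ := exists_tangential_taylor hf hc
  obtain ⟨M, hM0, hM⟩ := exists_forall_abs_le (n := n)
    (u := fun x => f x) (hf.continuous.comp continuous_subtype_val)
  obtain ⟨B, hB0, hB⟩ := exists_forall_abs_le (n := n)
    (u := fun x => ‖tangentialGradient f x‖)
    ((contDiff_tangentialGradient hf).continuous.comp continuous_subtype_val).norm
  simp only [abs_norm] at hB
  -- `M + B²/2 + 1` bounds the loss in the radial factor per unit of `|ε|`; `2 * C` accounts for the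
  -- Taylor error, written as a multiple of `d²/2`. `K` is then chosen for
  -- `quadratic_remainder_nonneg`.
  set N := M + B ^ 2 / 2 + 1 + 2 * C with hN
  have hN0 : 0 ≤ N := by positivity
  set K := B ^ 2 * N with hK
  have hK0 : 0 ≤ K := by positivity
  have hs1 : ∀ᶠ ε in 𝓝 (0 : ℝ), N * |ε| < 1 / 2 :=
    eventually_nhds_zero_lt (by fun_prop) (by norm_num)
  have hs2 : ∀ᶠ ε in 𝓝 (0 : ℝ), K * |ε| < 1 :=
    eventually_nhds_zero_lt (by fun_prop) (by norm_num)
  have hs3 : ∀ᶠ ε in 𝓝 (0 : ℝ), |ε| < 1 :=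
    eventually_nhds_zero_lt (by fun_prop) (by norm_num)
  refine ⟨K, hK0, ?_⟩
  filter_upwards [hs1, hs2, hs3] with ε h1 h2 h3 x y
  rw [real_inner_comm, inner_sphere_eq]
  have hT := hC x y
  set d := ‖(y : Amb n) - x‖
  set T := f y - f x - ⟪tangentialGradient f x, (y : Amb n) - x⟫ with hTdef
  set β := ‖tangentialGradient f x‖ with hβ
  set e := |ε| with he
  have he0 : 0 ≤ e := abs_nonneg _
  have hε2 : ε ^ 2 = e ^ 2 := (sq_abs ε).symm
  have hβ0 : 0 ≤ β := norm_nonneg _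
  have hβB : β ^ 2 ≤ B ^ 2 := by gcongr; exact hB x
  have h4 : -(e * (C * d ^ 2)) ≤ ε * T := by
    have : |ε * T| ≤ e * (C * d ^ 2) := by rw [abs_mul]; gcongr
    exact (abs_le.1 this).1
  have h5 : -(e * M) ≤ ε * f x := by
    have : |ε * f x| ≤ e * M := by rw [abs_mul]; gcongr; exact hM x
    exact (abs_le.1 this).1
  have h6 : -(e * (β * d)) ≤ ε * ⟪tangentialGradient f x, (y : Amb n) - x⟫ := by
    have : |ε * ⟪tangentialGradient f x, (y : Amb n) - x⟫| ≤ e * (β * d) := by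
      rw [abs_mul]; gcongr; exact abs_real_inner_le_norm _ _
    exact (abs_le.1 this).1
  have h7 : e ^ 2 * β ^ 2 / 2 ≤ e * (B ^ 2 / 2) := by
    have : e ^ 2 ≤ e := by nlinarith
    nlinarith [mul_le_mul this hβB (sq_nonneg β) he0]
  have h8 : K * e ^ 3 ≤ e := by
    have : e ^ 2 ≤ 1 := by nlinarith
    nlinarith [mul_le_mul h2.le this (by positivity) zero_le_one]
  have h9 : 1 - (N - 2 * C) * e ≤ 1 + ε * f x - e ^ 2 * β ^ 2 / 2 - K * e ^ 3 := by
    rw [hN]; nlinarith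
  have h10 := mul_le_mul_of_nonneg_right h9 (by positivity : 0 ≤ d ^ 2 / 2)
  have h11 := quadratic_remainder_nonneg (t := d) (β := β) he0 h1.le
    (mul_le_mul_of_nonneg_right hβB hN0) hK0
  rw [hε2]
  have h12 : ε * f y = ε * T + ε * f x + ε * ⟪tangentialGradient f x, (y : Amb n) - x⟫ := by
    rw [hTdef]; ring
  rw [h12]
  linarith

/-- Lower bound for the volume of a body in terms of a lower bound `ρ` of its radial function. -/
theorem integral_pow_le_volume_body {h ρ : Sph n → ℝ} (hh : Continuous h) (hh0 : ∀ x, 0 ≤ h x)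
    (hρ : Continuous ρ) (hρ0 : ∀ x, 0 < ρ x)
    (hle : ∀ x y : Sph n, ρ x * ⟪(y : Amb n), (x : Amb n)⟫ ≤ h y) :
    (∫ x, ρ x ^ (n + 1) ∂(surf n)) / ((n : ℝ) + 1) ≤ volume.real (body h) := by
  let T : Set (Sph n × Ioi (0 : ℝ)) := {a | (a.2 : ℝ) < ρ a.1}
  have hT : MeasurableSet T := (isOpen_lt (by fun_prop) (by fun_prop)).measurableSet
  let Φ := homeomorphUnitSphereProd (Amb n)
  -- The star-shaped set below `ρ`, without the origin, lies in the body; its volume is exact in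
  -- polar coordinates. Half-spaces facing away from the ray hold trivially since `h ≥ 0`.
  have hsub : ((↑) '' (Φ ⁻¹' T) : Set (Amb n)) ⊆ body h := by
    rintro _ ⟨z, hz, rfl⟩ y
    have hz' : ((Φ z).2 : ℝ) < ρ (Φ z).1 := hz
    rw [homeomorphUnitSphereProd_apply_snd_coe] at hz'
    have hzx : (z : Amb n) = ‖(z : Amb n)‖ • ((Φ z).1 : Amb n) := by
      have : (z : Amb n) ≠ 0 := z.2
      simp [Φ, smul_smul, this]
    rw [hzx, inner_smul_right]
    rcases le_or_gt 0 ⟪(y : Amb n), ((Φ z).1 : Amb n)⟫ with h0 | h0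
    · exact (mul_le_mul_of_nonneg_right hz'.le h0).trans (hle _ _)
    · exact (mul_nonpos_of_nonneg_of_nonpos (norm_nonneg _) h0.le).trans (hh0 y)
  have hvol : volume ((↑) '' (Φ ⁻¹' T) : Set (Amb n)) =
      ENNReal.ofReal ((∫ x, ρ x ^ (n + 1) ∂(surf n)) / ((n : ℝ) + 1)) := by
    rw [← comap_subtype_coe_apply (measurableSet_singleton _).compl,
      (volume.measurePreserving_homeomorphUnitSphereProd (E := Amb n)).measure_preimage
        hT.nullMeasurableSet, Measure.prod_apply hT, ← integral_div,
      ofReal_integral_eq_lintegral_ofReal (integrable_surf (by fun_prop))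
        (ae_of_all _ fun x => by have := (hρ0 x).le; positivity)]
    refine lintegral_congr fun x => ?_
    have : Prod.mk x ⁻¹' T = Iio ⟨ρ x, hρ0 x⟩ := by
      ext r; simp [T, ← Subtype.coe_lt_coe]
    rw [this, Measure.volumeIoiPow_apply_Iio]
    simp
  have h1 : ENNReal.ofReal ((∫ x, ρ x ^ (n + 1) ∂(surf n)) / ((n : ℝ) + 1)) ≤ volume (body h) :=
    hvol ▸ measure_mono hsub
  exact (ENNReal.ofReal_le_iff_le_toReal (isCompact_body hh).measure_lt_top.ne).1 h1

end

/-! ### Polynomial dependence of the volume -/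

/-- The determinant of `1 + ε A` is a polynomial in `ε` of degree at most the dimension. -/
theorem exists_polynomial_det_one_add_smul {E : Type*} [NormedAddCommGroup E] [NormedSpace ℝ E]
    [FiniteDimensional ℝ E] (A : E →L[ℝ] E) :
    ∃ P : Polynomial ℝ, P.natDegree ≤ Module.finrank ℝ E ∧
      ∀ ε : ℝ, P.eval ε = (ContinuousLinearMap.id ℝ E + ε • A).det := by
  let b := Module.finBasis ℝ E
  let M := LinearMap.toMatrix b b (A : E →ₗ[ℝ] E)
  refine ⟨_, (Polynomial.natDegree_det_X_add_C_le M 1).trans (by simp), fun ε => ?_⟩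
  rw [ContinuousLinearMap.det, ← LinearMap.det_toMatrix b, ← Polynomial.coe_evalRingHom,
    RingHom.map_det]
  congr 1
  ext i j
  simp [M, Matrix.one_apply, LinearMap.toMatrix_apply, Finsupp.single_apply, eq_comm, apply_ite]
  split_ifs <;> ring

/-- An integral of polynomial functions of bounded degree depends polynomially on the
parameter. -/
theorem exists_polynomial_integral {X : Type*} [MeasurableSpace X] {μ : Measure X} (d : ℕ)
    {F : ℝ → X → ℝ} (hF : ∀ ε, Integrable (F ε) μ)
    (hP : ∀ x, ∃ P : Polynomial ℝ, P.natDegree ≤ d ∧ ∀ ε, P.eval ε = F ε x) :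
    ∃ Q : Polynomial ℝ, ∀ ε, Q.eval ε = ∫ x, F ε x ∂μ := by
  let v : ℕ → ℝ := fun k => k
  let s := Finset.range (d + 1)
  have hv : Set.InjOn v s := Nat.cast_injective.injOn
  refine ⟨Lagrange.interpolate s v fun k => ∫ x, F (v k) x ∂μ, fun ε => ?_⟩
  -- Interpolating at the nodes `0, …, d` expresses every `F ε` through finitely many integrable
  -- functions, so integrability of the coefficients never has to be discussed.
  have key : ∀ x, F ε x = ∑ k ∈ s, F (v k) x * (Lagrange.basis s v k).eval ε := by
    intro x
    obtain ⟨P, hPd, hPe⟩ := hP x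
    have h1 : P.degree < s.card := by
      refine Polynomial.degree_le_natDegree.trans_lt ?_
      simp only [s, Finset.card_range]
      exact_mod_cast Nat.lt_succ_of_le hPd
    have h2 := Lagrange.eq_interpolate_of_eval_eq (r := fun k => F (v k) x) hv h1
      (fun k _ => hPe _)
    rw [← hPe, h2, Lagrange.interpolate_apply, Polynomial.eval_finsetSum]
    simp
  simp_rw [key]
  rw [integral_finsetSum _ fun k _ => (hF _).mul_const _, Lagrange.interpolate_apply,
    Polynomial.eval_finsetSum]
  simp [integral_mul_const]

section
variable {n : ℕ} {f : Amb n → ℝ}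

/-- The body with support function `1 + ε f` is the image of the unit ball under a small
perturbation of the identity. -/
theorem eventually_image_eq_body (hf : ContDiff ℝ ∞ f) (hc : HasCompactSupport f) :
    ∀ᶠ ε in 𝓝 (0 : ℝ), Function.Injective (fun y => y + ε • supportField f y) ∧
      (fun y => y + ε • supportField f y) '' closedBall 0 1 =
        body (fun x : Sph n => 1 + ε * f x) := by
  obtain ⟨L, hL⟩ := ((contDiff_supportField hf).of_le (m := 1) (by simp)
    ).lipschitzWith_of_hasCompactSupport (hasCompactSupport_supportField hc) one_ne_zero
  obtain ⟨M, hM⟩ := (contDiff_supportField hf).continuous.bounded_above_of_compact_support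
    (hasCompactSupport_supportField hc)
  obtain ⟨m, hm0, hm⟩ := exists_forall_abs_le (n := n)
    (u := fun x => f x) (hf.continuous.comp continuous_subtype_val)
  have hM0 : 0 ≤ M := (norm_nonneg _).trans (hM 0)
  have hs1 : ∀ᶠ ε in 𝓝 (0 : ℝ), |ε| * (L + M) < 1 / 2 :=
    eventually_nhds_zero_lt (by fun_prop) (by norm_num)
  have hs2 : ∀ᶠ ε in 𝓝 (0 : ℝ), |ε| * m < 1 / 2 :=
    eventually_nhds_zero_lt (by fun_prop) (by norm_num)
  filter_upwards [hs1, hs2, eventually_inner_supportField_le hf hc] with ε h1 h2 h3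
  set G := supportField f with hG
  set F : Amb n → Amb n := fun y => y + ε • G y with hF
  -- A perturbation of the identity with Lipschitz constant below `1` is bijective. Surjectivity is
  -- what allows a point of the body to be written as `F z`.
  have happ : ApproximatesLinearOn F (ContinuousLinearEquiv.refl ℝ (Amb n) : Amb n →L[ℝ] Amb n)
      univ (‖ε‖₊ * L) := by
    intro x _ y _
    have h : F x - F y - (x - y) = ε • (G x - G y) := by simp only [hF]; module
    simp only [ContinuousLinearEquiv.coe_refl, ContinuousLinearMap.id_apply, h, norm_smul]
    have := hL.dist_le_mul x y
    rw [dist_eq_norm, dist_eq_norm] at this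
    push_cast
    rw [mul_assoc]
    gcongr
  have hcN : ‖ε‖₊ * L < ‖((ContinuousLinearEquiv.refl ℝ (Amb n)).symm : Amb n →L[ℝ] Amb n)‖₊⁻¹ := by
    have : ‖((ContinuousLinearEquiv.refl ℝ (Amb n)).symm : Amb n →L[ℝ] Amb n)‖₊ = 1 := by
      ext; simp
    rw [this, inv_one, ← NNReal.coe_lt_coe]
    push_cast
    rw [Real.norm_eq_abs]
    nlinarith [abs_nonneg ε, mul_nonneg (abs_nonneg ε) hM0]
  have hinj : Function.Injective F := by
    simpa [injOn_univ] using happ.injOn (Or.inr hcN)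
  have hsurj : Function.Surjective F := happ.surjective (Or.inr hcN)
  have hh : ∀ x : Sph n, 1 / 2 < 1 + ε * f x := by
    intro x
    have : |ε * f x| ≤ |ε| * m := by rw [abs_mul]; gcongr; exact hm x
    linarith [(abs_le.1 this).1]
  -- `G` need not be homogeneous off the sphere, but along a ray `F` deviates from homogeneity by at
  -- most `|1 - r| / 2`. As `1 + ε f > 1/2`, this is too little to push interior points out of the
  -- body or exterior points into it.
  have hscale : ∀ (x y : Sph n) (r : ℝ), 0 ≤ r →
      |⟪(y : Amb n), F (r • (x : Amb n))⟫ - r * ⟪(y : Amb n), F x⟫| ≤ |1 - r| / 2 := by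
    intro x y r hr
    have h4 : F (r • (x : Amb n)) - r • F x =
        ε • ((G (r • (x : Amb n)) - G x) + (1 - r) • G x) := by simp only [hF]; module
    have h5 : ‖G (r • (x : Amb n)) - G x‖ ≤ L * |1 - r| := by
      have := hL.dist_le_mul (r • (x : Amb n)) x
      rw [dist_eq_norm, dist_eq_norm] at this
      refine this.trans_eq ?_
      have h6 : r • (x : Amb n) - x = (r - 1) • (x : Amb n) := by module
      rw [h6, norm_smul, abs_sub_comm]
      simp
    rw [← inner_smul_right, ← inner_sub_right, h4]
    refine (abs_real_inner_le_norm _ _).trans ?_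
    rw [norm_smul]
    have h7 := norm_add_le (G (r • (x : Amb n)) - G x) ((1 - r) • G x)
    rw [norm_smul] at h7
    have h8 := mul_le_mul_of_nonneg_left (hM x) (abs_nonneg (1 - r))
    simp only [Real.norm_eq_abs] at h7 ⊢
    have hy : ‖(y : Amb n)‖ = 1 := by simp
    rw [hy, one_mul]
    calc |ε| * ‖G (r • (x : Amb n)) - G x + (1 - r) • G x‖
        ≤ |ε| * ((L + M) * |1 - r|) := by gcongr; linarith
      _ = (|ε| * (L + M)) * |1 - r| := by ring
      _ ≤ (1 / 2) * |1 - r| := by gcongr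
      _ = |1 - r| / 2 := by ring
  have hray : ∀ z : Amb n, ∃ x : Sph n, z = ‖z‖ • (x : Amb n) := by
    intro z
    rcases eq_or_ne z 0 with rfl | hz
    · exact ⟨Classical.arbitrary _, by simp⟩
    · exact exists_eq_norm_smul hz
  refine ⟨hinj, Subset.antisymm ?_ ?_⟩
  · rintro _ ⟨z, hz, rfl⟩ y
    obtain ⟨x, hx⟩ := hray z
    have hz1 : ‖z‖ ≤ 1 := by simpa using hz
    have h4 := (abs_le.1 (hscale x y ‖z‖ (norm_nonneg z))).2
    rw [← hx, abs_of_nonneg (by linarith)] at h4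
    have h5 : ⟪(y : Amb n), F x⟫ ≤ 1 + ε * f y := h3 x y
    have h6 := mul_le_mul_of_nonneg_left h5 (norm_nonneg z)
    have h7 := mul_le_mul_of_nonneg_right (hh y).le (by linarith : 0 ≤ 1 - ‖z‖)
    change ⟪(y : Amb n), F z⟫ ≤ 1 + ε * f y
    linarith
  · intro w hw
    obtain ⟨z, rfl⟩ := hsurj w
    refine ⟨z, ?_, rfl⟩
    by_contra hz
    have hz1 : 1 < ‖z‖ := by simpa using hz
    obtain ⟨x, hx⟩ := hray z
    have h4 := (abs_le.1 (hscale x x ‖z‖ (norm_nonneg z))).1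
    rw [← hx, abs_of_neg (by linarith)] at h4
    have h5 : ⟪(x : Amb n), F x⟫ = 1 + ε * f x := inner_supportField_self f x ε
    rw [h5] at h4
    have h6 : ⟪(x : Amb n), F z⟫ ≤ 1 + ε * f x := hw x
    have h7 := mul_lt_mul_of_pos_right (hh x) (by linarith : 0 < ‖z‖ - 1)
    linarith

/-- The volume of the body with support function `1 + ε f` is a polynomial in `ε` near `0`. -/
theorem exists_polynomial_volume_body (hf : ContDiff ℝ ∞ f) (hc : HasCompactSupport f) :
    ∃ Q : Polynomial ℝ, ∀ᶠ ε in 𝓝 (0 : ℝ),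
      volume.real (body (fun x : Sph n => 1 + ε * f x)) = Q.eval ε := by
  have hG := contDiff_supportField hf
  have hGd : Continuous (fderiv ℝ (supportField f)) := hG.continuous_fderiv (by simp)
  let D : ℝ → Amb n → ℝ := fun ε y =>
    (ContinuousLinearMap.id ℝ (Amb n) + ε • fderiv ℝ (supportField f) y).det
  have hD : Continuous fun a : ℝ × Amb n => D a.1 a.2 :=
    ContinuousLinearMap.continuous_det.comp (by fun_prop)
  have hK : IsCompact (closedBall (0 : Amb n) 1) := isCompact_closedBall _ _
  have hint : ∀ ε, IntegrableOn (D ε) (closedBall 0 1) := fun ε =>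
    (hD.comp (by fun_prop : Continuous fun y : Amb n => (ε, y))).continuousOn.integrableOn_compact
      hK
  obtain ⟨Q, hQ⟩ := exists_polynomial_integral (n + 1) (F := D) hint fun y => by
    simpa using! exists_polynomial_det_one_add_smul (fderiv ℝ (supportField f) y)
  refine ⟨Q, ?_⟩
  have hpos : ∀ᶠ ε in 𝓝 (0 : ℝ), ∀ y ∈ closedBall (0 : Amb n) 1, 0 < D ε y := by
    refine hK.eventually_forall_of_forall_eventually (P := fun ε y => 0 < D ε y) fun y _ => ?_
    refine hD.continuousAt.eventually (lt_mem_nhds ?_)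
    simp [D, ContinuousLinearMap.det]
  filter_upwards [hpos, eventually_image_eq_body hf hc] with ε h1 ⟨h2, h3⟩
  have h4 := lintegral_abs_det_fderiv_eq_addHaar_image volume
    (s := closedBall (0 : Amb n) 1) (f := fun y => y + ε • supportField f y)
    (f' := fun y => ContinuousLinearMap.id ℝ (Amb n) + ε • fderiv ℝ (supportField f) y)
    measurableSet_closedBall
    (fun y _ => ((hasFDerivAt_id y).add
      (((hG.differentiable (by simp)) y).hasFDerivAt.const_smul ε)).hasFDerivWithinAt) h2.injOn
  rw [hQ, measureReal_def, ← h3, ← h4, integral_eq_lintegral_of_nonneg_ae]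
  · congr 1
    refine setLIntegral_congr_fun measurableSet_closedBall fun y hy => ?_
    rw [abs_of_pos (h1 y hy)]
  · filter_upwards [ae_restrict_mem measurableSet_closedBall] with y hy using (h1 y hy).le
  · exact (hint ε).aestronglyMeasurable

end

/-! ### Second order coefficients of the volume -/

/-- Second order expansion of `(1 + s) ^ m` with a cubic error. -/
theorem exists_one_add_pow_expansion (m : ℕ) : ∃ C, 0 ≤ C ∧ ∀ s : ℝ, |s| ≤ 1 →
    |(1 + s) ^ m - (1 + m * s + m * (m - 1) / 2 * s ^ 2)| ≤ C * |s| ^ 3 := by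
  induction m with
  | zero => exact ⟨0, le_rfl, fun s _ => by simp⟩
  | succ m ih =>
    obtain ⟨C, hC0, hC⟩ := ih
    refine ⟨2 * C + |(m : ℝ) * (m - 1) / 2|, by positivity, fun s hs => ?_⟩
    have h1 : (1 + s) ^ (m + 1) - (1 + ((m + 1 : ℕ) : ℝ) * s +
        ((m + 1 : ℕ) : ℝ) * (((m + 1 : ℕ) : ℝ) - 1) / 2 * s ^ 2) =
        (1 + s) * ((1 + s) ^ m - (1 + m * s + m * (m - 1) / 2 * s ^ 2)) +
          m * (m - 1) / 2 * s ^ 3 := by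
      push_cast; ring
    have h2 : |1 + s| ≤ 2 := (abs_add_le _ _).trans (by rw [abs_one]; linarith)
    rw [h1]
    refine (abs_add_le _ _).trans ?_
    rw [abs_mul, abs_mul _ (s ^ 3), abs_pow, add_mul]
    have := mul_le_mul h2 (hC s hs) (abs_nonneg _) zero_le_two
    linarith

/-- A polynomial which dominates a quadratic polynomial up to a cubic error, with equality at `0`,
has the same first order coefficient and a larger second order coefficient. -/
theorem Polynomial.coeff_of_eventually_le {Q : Polynomial ℝ} {b c C : ℝ}
    (h : ∀ᶠ ε in 𝓝 (0 : ℝ), Q.coeff 0 + b * ε + c * ε ^ 2 - C * |ε| ^ 3 ≤ Q.eval ε) :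
    Q.coeff 1 = b ∧ c ≤ Q.coeff 2 := by
  let R := Q.divX.divX.divX
  have hQ : ∀ ε, Q.eval ε = Q.coeff 0 + Q.coeff 1 * ε + Q.coeff 2 * ε ^ 2 + R.eval ε * ε ^ 3 := by
    intro ε
    have h1 : ∀ P : Polynomial ℝ, P.eval ε = P.divX.eval ε * ε + P.coeff 0 := fun P => by
      conv_lhs => rw [← P.divX_mul_X_add]
      simp
    rw [h1 Q, h1 Q.divX, h1 Q.divX.divX]
    simp only [coeff_divX, R]
    ring
  have hR : Continuous fun ε => R.eval ε := R.continuous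
  -- Dividing by `ε` keeps the inequality on the right and reverses it on the left; the two limits
  -- pin the linear coefficient. A second division on the right gives the quadratic one.
  have hpos : ∀ᶠ ε in 𝓝[>] (0 : ℝ),
      0 ≤ (Q.coeff 1 - b) + (Q.coeff 2 - c) * ε + (R.eval ε + C) * ε ^ 2 := by
    filter_upwards [nhdsWithin_le_nhds h, self_mem_nhdsWithin] with ε hε (h0 : 0 < ε)
    rw [hQ, abs_of_pos h0] at hε
    refine (mul_nonneg_iff_of_pos_left h0).1 ?_
    linarith
  have hneg : ∀ᶠ ε in 𝓝[<] (0 : ℝ),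
      (Q.coeff 1 - b) + (Q.coeff 2 - c) * ε + (R.eval ε - C) * ε ^ 2 ≤ 0 := by
    filter_upwards [nhdsWithin_le_nhds h, self_mem_nhdsWithin] with ε hε (h0 : ε < 0)
    rw [hQ, abs_of_neg h0] at hε
    refine nonpos_of_mul_nonneg_right (a := ε) ?_ h0
    linarith
  have h1 : b ≤ Q.coeff 1 := by
    have ht : Tendsto (fun ε => (Q.coeff 1 - b) + (Q.coeff 2 - c) * ε + (R.eval ε + C) * ε ^ 2)
        (𝓝[>] 0) (𝓝 (Q.coeff 1 - b)) :=
      (Continuous.tendsto' (by fun_prop) _ _ (by simp)).mono_left nhdsWithin_le_nhds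
    linarith [ge_of_tendsto ht hpos]
  have h2 : Q.coeff 1 ≤ b := by
    have ht : Tendsto (fun ε => (Q.coeff 1 - b) + (Q.coeff 2 - c) * ε + (R.eval ε - C) * ε ^ 2)
        (𝓝[<] 0) (𝓝 (Q.coeff 1 - b)) :=
      (Continuous.tendsto' (by fun_prop) _ _ (by simp)).mono_left nhdsWithin_le_nhds
    linarith [le_of_tendsto ht hneg]
  have h3 : Q.coeff 1 = b := le_antisymm h2 h1
  refine ⟨h3, ?_⟩
  have ht : Tendsto (fun ε => (Q.coeff 2 - c) + (R.eval ε + C) * ε)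
      (𝓝[>] 0) (𝓝 (Q.coeff 2 - c)) :=
    (Continuous.tendsto' (by fun_prop) _ _ (by simp)).mono_left nhdsWithin_le_nhds
  have hpos' : ∀ᶠ ε in 𝓝[>] (0 : ℝ), 0 ≤ (Q.coeff 2 - c) + (R.eval ε + C) * ε := by
    filter_upwards [hpos, self_mem_nhdsWithin] with ε hε (h0 : 0 < ε)
    rw [h3] at hε
    refine (mul_nonneg_iff_of_pos_left h0).1 ?_
    linarith
  linarith [ge_of_tendsto ht hpos']

section
variable {n : ℕ} {f : Amb n → ℝ}

/-- A second order lower bound for the volume of the body with support function `1 + ε f`. -/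
theorem exists_volume_body_lower_bound (hf : ContDiff ℝ ∞ f) (hc : HasCompactSupport f) :
    ∃ C, ∀ᶠ ε in 𝓝 (0 : ℝ),
      (surf n).real univ / ((n : ℝ) + 1) + (∫ x : Sph n, f x ∂(surf n)) * ε +
        (n / 2 * ∫ x : Sph n, f x ^ 2 ∂(surf n) -
          (∫ x : Sph n, ‖tangentialGradient f x‖ ^ 2 ∂(surf n)) / 2) * ε ^ 2 - C * |ε| ^ 3 ≤
      volume.real (body (fun x : Sph n => 1 + ε * f x)) := by
  have hfc : Continuous fun x : Sph n => f x := hf.continuous.comp continuous_subtype_val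
  have hgc : Continuous fun x : Sph n => ‖tangentialGradient f x‖ ^ 2 :=
    ((contDiff_tangentialGradient hf).continuous.comp continuous_subtype_val).norm.pow 2
  obtain ⟨K, hK0, hK⟩ := eventually_radial_lower_bound hf hc
  obtain ⟨M, hM0, hM⟩ := exists_forall_abs_le hfc
  obtain ⟨B, hB0, hB⟩ := exists_forall_abs_le hgc
  obtain ⟨A, hA0, hA⟩ := exists_one_add_pow_expansion (n + 1)
  set W := M + B + K with hW
  have hW0 : 0 ≤ W := by positivity
  set m : ℝ := (n : ℝ) + 1 with hm
  have hm0 : 0 < m := by positivity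
  -- The three summands cover the cubic error in the linear term, the cross term of `s²`, and the
  -- remainder of the binomial expansion, where `|s| ≤ |ε| W`.
  set C' := m * K + m * n / 2 * (2 * M * (B + K)) + A * W ^ 3 with hC'
  have hs1 : ∀ᶠ ε in 𝓝 (0 : ℝ), |ε| < 1 := eventually_nhds_zero_lt (by fun_prop) (by norm_num)
  have hs2 : ∀ᶠ ε in 𝓝 (0 : ℝ), |ε| * W < 1 :=
    eventually_nhds_zero_lt (by fun_prop) (by norm_num)
  refine ⟨C' / m * (surf n).real univ, ?_⟩
  filter_upwards [hK, hs1, hs2] with ε h1 h2 h3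
  set e := |ε| with he
  have he0 : 0 ≤ e := abs_nonneg _
  have hε2 : ε ^ 2 = e ^ 2 := (sq_abs ε).symm
  have he3 : e ^ 3 ≤ e ^ 2 := pow_le_pow_of_le_one he0 h2.le (by norm_num)
  have he2 : e ^ 2 ≤ e := by simpa using pow_le_pow_of_le_one he0 h2.le (by norm_num : 1 ≤ 2)
  have hfM : ∀ x : Sph n, |ε * f x| ≤ e * M := fun x => by rw [abs_mul]; gcongr; exact hM x
  have hpt : ∀ x : Sph n, 0 < 1 + ε * f x - ε ^ 2 * ‖tangentialGradient f x‖ ^ 2 / 2 - K * e ^ 3 ∧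
      m * (1 / m + ε * f x + (n / 2 * f x ^ 2 - ‖tangentialGradient f x‖ ^ 2 / 2) * ε ^ 2 -
        C' / m * e ^ 3) ≤
      (1 + ε * f x - ε ^ 2 * ‖tangentialGradient f x‖ ^ 2 / 2 - K * e ^ 3) ^ (n + 1) := by
    intro x
    set k := ‖tangentialGradient f x‖ ^ 2 with hk
    have hk0 : 0 ≤ k := by positivity
    have hkB : k ≤ B := (le_abs_self _).trans (hB x)
    set r := ε ^ 2 * k / 2 + K * e ^ 3 with hr
    have hr0 : 0 ≤ r := by positivity
    have hrB : r ≤ e ^ 2 * (B + K) := by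
      rw [hr, hε2]
      nlinarith [mul_le_mul_of_nonneg_left hkB (sq_nonneg e), mul_le_mul_of_nonneg_left he3 hK0,
        mul_nonneg (sq_nonneg e) hk0]
    set s := ε * f x - r with hs
    have hsW : |s| ≤ e * W := by
      have h4 : |s| ≤ |ε * f x| + |r| := abs_sub _ _
      rw [abs_of_nonneg hr0] at h4
      have h5 := mul_le_mul_of_nonneg_right he2 (by positivity : 0 ≤ B + K)
      linarith [hfM x]
    have hs1 : |s| < 1 := hsW.trans_lt h3
    have h6 : 1 + ε * f x - ε ^ 2 * k / 2 - K * e ^ 3 = 1 + s := by rw [hs, hr]; ring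
    rw [h6]
    refine ⟨by linarith [(abs_lt.1 hs1).1], ?_⟩
    have h7 := (abs_le.1 (hA s hs1.le)).1
    have h8 : A * |s| ^ 3 ≤ A * (W ^ 3 * e ^ 3) := by
      rw [← mul_pow, mul_comm W]
      gcongr
    have h9 : (ε * f x) ^ 2 - 2 * M * (B + K) * e ^ 3 ≤ s ^ 2 := by
      have h10 : ε * f x * r ≤ e * M * (e ^ 2 * (B + K)) :=
        mul_le_mul ((le_abs_self _).trans (hfM x)) hrB hr0 (by positivity)
      nlinarith [sq_nonneg r]
    push_cast at h7
    rw [← hm] at h7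
    have h11 : m * (m - 1) / 2 = m * n / 2 := by rw [hm]; ring
    rw [h11] at h7
    have h12 := mul_le_mul_of_nonneg_left h9 (by positivity : 0 ≤ m * n / 2)
    have h13 : m * (1 / m + ε * f x + (n / 2 * f x ^ 2 - k / 2) * ε ^ 2 - C' / m * e ^ 3) =
        1 + m * (ε * f x) + (m * n / 2 * (ε * f x) ^ 2 - m * (ε ^ 2 * k / 2)) - C' * e ^ 3 := by
      field_simp
    rw [h13, hC']
    have h14 : m * s = m * (ε * f x) - m * (ε ^ 2 * k / 2) - m * K * e ^ 3 := by
      rw [hs, hr]; ring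
    linarith
  have hh0 : ∀ x : Sph n, 0 ≤ 1 + ε * f x := by
    intro x
    have h4 := (abs_le.1 (hfM x)).1
    have : e * M ≤ e * W := by gcongr; rw [hW]; linarith
    linarith
  have hcont : Continuous fun x : Sph n =>
      1 + ε * f x - ε ^ 2 * ‖tangentialGradient f x‖ ^ 2 / 2 - K * e ^ 3 := by fun_prop
  refine le_trans ?_ (integral_pow_le_volume_body (by fun_prop) hh0 hcont (fun x => (hpt x).1) h1)
  rw [le_div_iff₀ hm0]
  have h15 := integral_mono (μ := surf n) (integrable_surf (by fun_prop))
    (integrable_surf (hcont.pow (n + 1))) fun x => (hpt x).2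
  refine le_trans (le_of_eq ?_) h15
  have i1 : Integrable (fun x : Sph n => ε * f x) (surf n) := integrable_surf (by fun_prop)
  have i2 : Integrable (fun x : Sph n => n / 2 * f x ^ 2) (surf n) :=
    integrable_surf (by fun_prop)
  have i3 : Integrable (fun x : Sph n => ‖tangentialGradient f x‖ ^ 2 / 2) (surf n) :=
    integrable_surf (by fun_prop)
  have i4 : Integrable (fun x : Sph n => 1 / m + ε * f x) (surf n) := integrable_surf (by fun_prop)
  have i5 : Integrable (fun x : Sph n =>
      (n / 2 * f x ^ 2 - ‖tangentialGradient f x‖ ^ 2 / 2) * ε ^ 2) (surf n) :=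
    integrable_surf (by fun_prop)
  have i6 : Integrable (fun x : Sph n =>
      1 / m + ε * f x + (n / 2 * f x ^ 2 - ‖tangentialGradient f x‖ ^ 2 / 2) * ε ^ 2) (surf n) :=
    i4.add i5
  rw [integral_const_mul, integral_sub i6 (integrable_const _), integral_add i4 i5,
    integral_add (integrable_const _) i1, integral_mul_const, integral_sub i2 i3,
    integral_const, integral_const, integral_const_mul, integral_const_mul, integral_div]
  simp only [smul_eq_mul]
  ring

/-- The volume of the body with support function `1 + ε f` is a polynomial near `ε = 0`, whose
first coefficients are explicit. -/
theorem exists_polynomial_volume_body_coeff (hf : ContDiff ℝ ∞ f) (hc : HasCompactSupport f) :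
    ∃ Q : Polynomial ℝ, (∀ᶠ ε in 𝓝 (0 : ℝ),
      volume.real (body (fun x : Sph n => 1 + ε * f x)) = Q.eval ε) ∧
      Q.coeff 0 = (surf n).real univ / ((n : ℝ) + 1) ∧
      Q.coeff 1 = ∫ x : Sph n, f x ∂(surf n) ∧
      n / 2 * ∫ x : Sph n, f x ^ 2 ∂(surf n) -
          (∫ x : Sph n, ‖tangentialGradient f x‖ ^ 2 ∂(surf n)) / 2 ≤ Q.coeff 2 := by
  obtain ⟨Q, hQ⟩ := exists_polynomial_volume_body hf hc
  obtain ⟨C, hC⟩ := exists_volume_body_lower_bound hf hc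
  have h0 : Q.coeff 0 = (surf n).real univ / ((n : ℝ) + 1) := by
    have := hQ.self_of_nhds
    rw [← volume_body_one, Polynomial.coeff_zero_eq_eval_zero, ← this]
    simp
  refine ⟨Q, hQ, h0, Polynomial.coeff_of_eventually_le (C := C) ?_⟩
  filter_upwards [hQ, hC] with ε h1 h2
  rwa [h0, ← h1]

end

/-! ### First and second variation at the constant function -/

section
variable {n : ℕ}

/-- Near `t = 0` the functions `1 + t u` are uniformly bounded and bounded away from zero. -/
theorem eventually_one_add_mul_mem_Icc {u : Sph n → ℝ} (hu : Continuous u) :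
    ∀ᶠ t in 𝓝 (0 : ℝ), ∀ x, 1 + t * u x ∈ Icc (1 / 2 : ℝ) (3 / 2) := by
  obtain ⟨M, hM0, hM⟩ := exists_forall_abs_le hu
  have hs : ∀ᶠ t in 𝓝 (0 : ℝ), |t| * M < 1 / 2 :=
    eventually_nhds_zero_lt (by fun_prop) (by norm_num)
  filter_upwards [hs] with t ht x
  have : |t * u x| ≤ |t| * M := by rw [abs_mul]; gcongr; exact hM x
  constructor <;> linarith [(abs_le.1 this).1, (abs_le.1 this).2]

/-- Differentiation of `∫ v (1 + t u) ^ s` under the integral sign. -/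
theorem eventually_hasDerivAt_integral_rpow {u v : Sph n → ℝ} (hu : Continuous u)
    (hv : Continuous v) (s : ℝ) : ∀ᶠ ε in 𝓝 (0 : ℝ),
      HasDerivAt (fun t => ∫ x, v x * (1 + t * u x) ^ s ∂(surf n))
        (s * ∫ x, v x * u x * (1 + ε * u x) ^ (s - 1) ∂(surf n)) ε := by
  obtain ⟨M, hM0, hM⟩ := exists_forall_abs_le (hv.mul hu)
  -- The base stays in `[1/2, 3/2]`, so the power is bounded whatever the sign of its exponent.
  obtain ⟨R, hR⟩ := (isCompact_Icc (a := (1 / 2 : ℝ)) (b := 3 / 2)).exists_bound_of_continuousOn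
    (f := fun y : ℝ => y ^ (s - 1)) (fun y hy => (Real.continuousAt_rpow_const _ _
      (Or.inl (by linarith [hy.1]))).continuousWithinAt)
  have hcont : ∀ {t : ℝ} (w : Sph n → ℝ) (r : ℝ), Continuous w →
      (∀ x, 1 + t * u x ∈ Icc (1 / 2 : ℝ) (3 / 2)) →
      Continuous fun x => w x * (1 + t * u x) ^ r := fun w r hw h =>
    hw.mul (Continuous.rpow_const (by fun_prop) fun x => Or.inl (by linarith [(h x).1]))
  filter_upwards [(eventually_one_add_mul_mem_Icc hu).eventually_nhds] with ε hε
  have h := hasDerivAt_integral_of_dominated_loc_of_deriv_le (μ := surf n)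
    (F := fun t x => v x * (1 + t * u x) ^ s)
    (F' := fun t x => s * (v x * u x * (1 + t * u x) ^ (s - 1)))
    (bound := fun _ => |s| * (M * R)) hε
    (hε.mono fun t ht => (hcont v s hv ht).aestronglyMeasurable)
    (integrable_surf (hcont v s hv hε.self_of_nhds))
    (continuous_const.mul
      (hcont _ (s - 1) (hv.mul hu) hε.self_of_nhds)).aestronglyMeasurable
    (ae_of_all _ fun x t ht => by
      rw [norm_mul, norm_mul, Real.norm_eq_abs, Real.norm_eq_abs (v x * u x)]
      gcongr
      · exact hM x
      · exact hR _ (ht x))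
    (integrable_const _)
    (ae_of_all _ fun x t ht => by
      have h1 : HasDerivAt (fun t => 1 + t * u x) (u x) t := by
        simpa using ((hasDerivAt_id t).mul_const (u x)).const_add 1
      have h2 := (h1.rpow_const (p := s) (Or.inl (by linarith [(ht x).1]))).const_mul (v x)
      convert! h2 using 1
      ring)
  have h2 := h.2
  rwa [integral_const_mul] at h2

theorem integral_rpow_pos {w : Sph n → ℝ} (hw : Continuous w) (h0 : ∀ x, 0 < w x) (p : ℝ) :
    0 < ∫ x, w x ^ p ∂(surf n) := by
  have hc : Continuous fun x => w x ^ p := hw.rpow_const fun x => Or.inl (h0 x).ne'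
  rw [integral_pos_iff_support_of_nonneg (fun x => (Real.rpow_pos_of_pos (h0 x) p).le)
    (integrable_surf hc)]
  have : Function.support (fun x => w x ^ p) = univ :=
    eq_univ_of_forall fun x => (Real.rpow_pos_of_pos (h0 x) p).ne'
  rw [this]
  exact isOpen_univ.measure_pos _ univ_nonempty

/-- The normalized variation of the constant function is a multiple of `1 + ε ξ`. -/
theorem variation_one_eq (p : ℝ) (ξ : Sph n → ℝ) (ε : ℝ) :
    variation p (fun _ => 1) ξ ε = fun x =>
      ((surf n).real univ ^ (1 / p) / (∫ y, (1 + ε * ξ y) ^ p ∂(surf n)) ^ (1 / p)) *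
        (1 + ε * ξ x) := by
  ext x
  simp only [variation]
  ring

theorem IsSymmetric.const_mul_one_add {q : Fin (n + 2) → Sph n} {ξ : Sph n → ℝ}
    (h : IsSymmetric q ξ) (c ε : ℝ) : IsSymmetric q fun x => c * (1 + ε * ξ x) :=
  fun φ hφ x => by simp only [h φ hφ x]

/-- Every smooth symmetric direction is admissible at the constant function. -/
theorem isAdmissible_one {p : ℝ} (hp : p ≠ 0) {q : Fin (n + 2) → Sph n} {ξ : Sph n → ℝ}
    (hξ : IsSmooth ξ) (hs : IsSymmetric q ξ) : IsAdmissible p q (fun _ => 1) ξ := by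
  refine ⟨hξ, hs, ?_⟩
  obtain ⟨f, hf, hc, hfξ⟩ := hξ.exists_contDiff_extension
  have hξc := hξ.continuous
  filter_upwards [eventually_inner_supportField_le hf hc, eventually_one_add_mul_mem_Icc hξc]
    with ε h1 h2
  have hpos : ∀ x, 0 < 1 + ε * ξ x := fun x => by linarith [(h2 x).1]
  have hcont : Continuous fun x => 1 + ε * ξ x := by fun_prop
  rw [variation_one_eq]
  have hJ := integral_rpow_pos hcont hpos p
  have hα := surf_real_univ_pos (n := n)
  set J := ∫ x, (1 + ε * ξ x) ^ p ∂(surf n) with hJdef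
  set c := (surf n).real univ ^ (1 / p) / J ^ (1 / p) with hcdef
  have hc0 : 0 < c := div_pos (Real.rpow_pos_of_pos hα _) (Real.rpow_pos_of_pos hJ _)
  have hcont' : Continuous fun x => c * (1 + ε * ξ x) := by fun_prop
  refine ⟨exists_eq_supportFn hcont' fun x => ?_, fun x => mul_pos hc0 (hpos x),
    (isCompact_body hcont').measure_lt_top, hs.const_mul_one_add c ε, ?_⟩
  · refine ⟨c • ((x : Amb n) + ε • supportField f x), ?_, fun y => ?_⟩
    · rw [inner_smul_right, inner_supportField_self, hfξ]
    · rw [inner_smul_right, ← hfξ]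
      exact mul_le_mul_of_nonneg_left (h1 x y) hc0.le
  · have h3 : ∀ x, (c * (1 + ε * ξ x)) ^ p = (surf n).real univ / J * (1 + ε * ξ x) ^ p := by
      intro x
      rw [Real.mul_rpow hc0.le (hpos x).le, hcdef, ← Real.div_rpow hα.le hJ.le,
        ← Real.rpow_mul (div_pos hα hJ).le, one_div_mul_cancel hp, Real.rpow_one]
    simp_rw [h3]
    rw [integral_const_mul, ← hJdef, div_mul_cancel₀ _ hJ.ne']

theorem const_one_mem_classB (p : ℝ) (q : Fin (n + 2) → Sph n) :
    (fun _ => 1 : Sph n → ℝ) ∈ classB p q := by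
  refine ⟨exists_eq_supportFn continuous_const fun x => ⟨x, by simp, fun y => ?_⟩,
    fun _ => one_pos, (isCompact_body continuous_const).measure_lt_top, fun _ _ _ => rfl, by simp⟩
  rw [inner_sphere_eq]
  linarith [sq_nonneg ‖(x : Amb n) - y‖]

/-- The energy along the normalized variation of the constant function. -/
theorem eventually_energy_variation (p : ℝ) {ξ : Sph n → ℝ} (hξ : Continuous ξ) :
    ∀ᶠ ε in 𝓝 (0 : ℝ), energy (variation p (fun _ => 1) ξ ε) =
      -((n : ℝ) + 1) * (((∫ x, (1 + ε * ξ x) ^ p ∂(surf n)) / (surf n).real univ) ^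
        (-((n : ℝ) + 1) / p) * volume.real (body fun x => 1 + ε * ξ x)) := by
  filter_upwards [eventually_one_add_mul_mem_Icc hξ] with ε h2
  have hpos : ∀ x, 0 < 1 + ε * ξ x := fun x => by linarith [(h2 x).1]
  have hJ := integral_rpow_pos (by fun_prop : Continuous fun x => 1 + ε * ξ x) hpos p
  have hα := surf_real_univ_pos (n := n)
  rw [variation_one_eq, energy]
  set J := ∫ x, (1 + ε * ξ x) ^ p ∂(surf n)
  have hc0 : 0 < (surf n).real univ ^ (1 / p) / J ^ (1 / p) :=
    div_pos (Real.rpow_pos_of_pos hα _) (Real.rpow_pos_of_pos hJ _)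
  rw [volume_body_smul hc0]
  congr 2
  rw [← Real.div_rpow hα.le hJ.le, ← Real.rpow_natCast, ← Real.rpow_mul (div_pos hα hJ).le,
    ← inv_div J, Real.inv_rpow (div_pos hJ hα).le, ← Real.rpow_neg (div_pos hJ hα).le]
  congr 1
  push_cast
  ring

/-- Near `ε = 0` the energy along the normalized variation of the constant function is explicit up
to a polynomial. -/
theorem exists_polynomial_energy_variation (p : ℝ) {f : Amb n → ℝ} (hf : ContDiff ℝ ∞ f)
    (hc : HasCompactSupport f) :
    ∃ Q : Polynomial ℝ, (∀ᶠ ε in 𝓝 (0 : ℝ),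
      energy (variation p (fun _ => 1) (fun x : Sph n => f x) ε) =
        -((n : ℝ) + 1) * (((∫ x : Sph n, (1 + ε * f x) ^ p ∂(surf n)) / (surf n).real univ) ^
          (-((n : ℝ) + 1) / p) * Q.eval ε)) ∧
      Q.coeff 0 = (surf n).real univ / ((n : ℝ) + 1) ∧
      Q.coeff 1 = ∫ x : Sph n, f x ∂(surf n) ∧
      n / 2 * ∫ x : Sph n, f x ^ 2 ∂(surf n) -
          (∫ x : Sph n, ‖tangentialGradient f x‖ ^ 2 ∂(surf n)) / 2 ≤ Q.coeff 2 := by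
  obtain ⟨Q, hQ, h⟩ := exists_polynomial_volume_body_coeff hf hc
  refine ⟨Q, ?_, h⟩
  filter_upwards [hQ, eventually_energy_variation p (hf.continuous.comp continuous_subtype_val)]
    with ε h1 h2
  rw [← h1]
  exact h2

/-- The derivative of the energy along the normalized variation of the constant function. -/
theorem eventually_hasDerivAt_energy {p : ℝ} {f : Amb n → ℝ} (hf : ContDiff ℝ ∞ f)
    {Q : Polynomial ℝ} (hQ : ∀ᶠ ε in 𝓝 (0 : ℝ),
      energy (variation p (fun _ => 1) (fun x : Sph n => f x) ε) =
        -((n : ℝ) + 1) * (((∫ x : Sph n, (1 + ε * f x) ^ p ∂(surf n)) / (surf n).real univ) ^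
          (-((n : ℝ) + 1) / p) * Q.eval ε)) :
    ∀ᶠ ε in 𝓝 (0 : ℝ), HasDerivAt
      (fun t => energy (variation p (fun _ => 1) (fun x : Sph n => f x) t))
      (-((n : ℝ) + 1) *
        ((p * (∫ x : Sph n, f x * (1 + ε * f x) ^ (p - 1) ∂(surf n)) / (surf n).real univ) *
          (-((n : ℝ) + 1) / p) *
          ((∫ x : Sph n, (1 + ε * f x) ^ p ∂(surf n)) / (surf n).real univ) ^
            (-((n : ℝ) + 1) / p - 1) * Q.eval ε +
        ((∫ x : Sph n, (1 + ε * f x) ^ p ∂(surf n)) / (surf n).real univ) ^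
            (-((n : ℝ) + 1) / p) * Q.derivative.eval ε)) ε := by
  have hfc : Continuous fun x : Sph n => f x := hf.continuous.comp continuous_subtype_val
  filter_upwards [hQ.eventually_nhds, eventually_one_add_mul_mem_Icc hfc,
    eventually_hasDerivAt_integral_rpow hfc continuous_const (v := fun _ => 1) p] with ε h1 h2 h3
  have hpos : ∀ x : Sph n, 0 < 1 + ε * f x := fun x => by linarith [(h2 x).1]
  have hJ := integral_rpow_pos (by fun_prop : Continuous fun x : Sph n => 1 + ε * f x) hpos p
  have hα := surf_real_univ_pos (n := n)
  simp only [one_mul] at h3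
  refine HasDerivAt.congr_of_eventuallyEq ?_ h1
  exact (((h3.div_const _).rpow_const (Or.inl (div_pos hJ hα).ne')).mul
    (Q.hasDerivAt ε)).const_mul _

/-- The constant function is a critical point. -/
theorem isCriticalPoint_one {p : ℝ} (hp : p ≠ 0) (q : Fin (n + 2) → Sph n) :
    IsCriticalPoint p q (fun _ => 1) := by
  refine ⟨const_one_mem_classB p q, fun ξ hξ => ?_⟩
  obtain ⟨f, hf, hc, hfξ⟩ := hξ.1.exists_contDiff_extension
  obtain rfl : ξ = fun x : Sph n => f x := funext fun x => (hfξ x).symm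
  obtain ⟨Q, hQ, h0, h1, -⟩ := exists_polynomial_energy_variation p hf hc
  have h := (eventually_hasDerivAt_energy hf hQ).self_of_nhds
  convert! h using 1
  have hα := (surf_real_univ_pos (n := n)).ne'
  rw [← Polynomial.coeff_zero_eq_eval_zero, ← Polynomial.coeff_zero_eq_eval_zero,
    Polynomial.coeff_derivative, h0, h1]
  have hn : (n : ℝ) + 1 ≠ 0 := by positivity
  simp [hα]
  field_simp
  ring_nf
  simp

/-- The second variation at the constant function in a direction of mean zero. -/
theorem hasSecondVariation_one {p : ℝ} (hp : p ≠ 0) {f : Amb n → ℝ} (hf : ContDiff ℝ ∞ f)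
    {Q : Polynomial ℝ} (hQ : ∀ᶠ ε in 𝓝 (0 : ℝ),
      energy (variation p (fun _ => 1) (fun x : Sph n => f x) ε) =
        -((n : ℝ) + 1) * (((∫ x : Sph n, (1 + ε * f x) ^ p ∂(surf n)) / (surf n).real univ) ^
          (-((n : ℝ) + 1) / p) * Q.eval ε))
    (h0 : Q.coeff 0 = (surf n).real univ / ((n : ℝ) + 1))
    (h1 : Q.coeff 1 = ∫ x : Sph n, f x ∂(surf n)) (hmean : ∫ x : Sph n, f x ∂(surf n) = 0) :
    HasSecondVariation p (fun _ => 1) (fun x : Sph n => f x)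
      (-((n : ℝ) + 1) * (2 * Q.coeff 2 - (p - 1) * ∫ x : Sph n, f x ^ 2 ∂(surf n))) := by
  refine ⟨_, eventually_hasDerivAt_energy hf hQ, ?_⟩
  have hfc : Continuous fun x : Sph n => f x := hf.continuous.comp continuous_subtype_val
  have d1 := (eventually_hasDerivAt_integral_rpow hfc continuous_const (v := fun _ => 1)
    p).self_of_nhds
  -- Weight `f` and exponent `p - 1`: this is the integral occurring in the first derivative of `J`.
  have d2 := (eventually_hasDerivAt_integral_rpow hfc hfc (p - 1)).self_of_nhds
  have hα := (surf_real_univ_pos (n := n)).ne'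
  have hne : (∫ x : Sph n, (1 + 0 * f x) ^ p ∂(surf n)) / (surf n).real univ ≠ 0 := by simp [hα]
  simp only [one_mul] at d1
  have hd := (((((d2.const_mul p).div_const ((surf n).real univ)).mul_const
    (-((n : ℝ) + 1) / p)).mul ((d1.div_const _).rpow_const (p := -((n : ℝ) + 1) / p - 1)
      (Or.inl hne))).mul (Q.hasDerivAt 0)).add
    (((d1.div_const _).rpow_const (p := -((n : ℝ) + 1) / p) (Or.inl hne)).mul
      (Q.derivative.hasDerivAt 0)) |>.const_mul (-((n : ℝ) + 1))
  convert! hd using 1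
  simp only [← Polynomial.coeff_zero_eq_eval_zero, Polynomial.coeff_derivative, h0, h1]
  have hn : (n : ℝ) + 1 ≠ 0 := by positivity
  simp [hα, hmean, ← pow_two]
  field_simp
  ring_nf
  simp

end

/-! ### Gaussian integrals in polar coordinates -/

section
variable {n : ℕ}

/-- The radial factor of a Gaussian integral of a `k`-homogeneous function; the density `r ^ n` of
`Measure.volumeIoiPow n` raises the exponent to `n + k`. -/
theorem integral_volumeIoiPow_pow_mul_exp (n k : ℕ) :
    ∫ r : Ioi (0 : ℝ), (r : ℝ) ^ k * Real.exp (-(r : ℝ) ^ 2) ∂(Measure.volumeIoiPow n) =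
      Real.Gamma (((n + k : ℕ) + 1) / 2) / 2 := by
  have h := integral_rpow_mul_exp_neg_rpow (p := 2) (q := ((n + k : ℕ) : ℝ)) two_pos
    (by have : (0 : ℝ) ≤ ((n + k : ℕ) : ℝ) := by positivity
        linarith)
  rw [Measure.volumeIoiPow]
  simp only [ENNReal.ofReal]
  rw [integral_withDensity_eq_integral_smul (measurable_subtype_coe.pow_const _).real_toNNReal,
    integral_subtype_comap measurableSet_Ioi
      fun a : ℝ => Real.toNNReal (a ^ n) • (a ^ k * Real.exp (-a ^ 2)), div_eq_inv_mul,
    ← one_div, ← h]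
  refine setIntegral_congr_fun measurableSet_Ioi fun x hx => ?_
  have hx0 : 0 ≤ x := le_of_lt hx
  simp only [NNReal.smul_def, Real.coe_toNNReal _ (pow_nonneg hx0 n), Real.rpow_natCast,
    smul_eq_mul, Real.rpow_two]
  ring

/-- A continuous homogeneous function is integrable against the Gaussian weight. -/
theorem integrable_mul_exp_neg_norm_sq {F : Amb n → ℝ} (hF : Continuous F) {k : ℕ}
    (hk : ∀ (r : ℝ) (x : Amb n), F (r • x) = r ^ k * F x) :
    Integrable fun x => F x * Real.exp (-‖x‖ ^ 2) := by
  obtain ⟨M, hM0, hM⟩ := exists_forall_abs_le (u := fun x : Sph n => F x)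
    (hF.comp continuous_subtype_val)
  have h1 : Integrable (fun x : Amb n => M * (‖x‖ ^ k * Real.exp (-‖x‖ ^ 2))) := by
    refine Integrable.const_mul ?_ M
    refine (integrable_fun_norm_addHaar (volume : Measure (Amb n))
      (f := fun r => r ^ k * Real.exp (-r ^ 2))).2 ?_
    have h2 := integrableOn_rpow_mul_exp_neg_mul_sq (b := 1) one_pos (s := ((n + k : ℕ) : ℝ))
      (by have : (0 : ℝ) ≤ ((n + k : ℕ) : ℝ) := by positivity
          linarith)
    refine h2.congr_fun (fun x _ => ?_) measurableSet_Ioi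
    simp only [Real.rpow_natCast, finrank_euclideanSpace, Fintype.card_fin, Nat.add_sub_cancel,
      smul_eq_mul, neg_one_mul]
    ring
  refine h1.mono' (by fun_prop) (ae_of_all _ fun x => ?_)
  have h3 : ∃ y : Sph n, x = ‖x‖ • (y : Amb n) := by
    rcases eq_or_ne x 0 with rfl | hz
    · exact ⟨Classical.arbitrary _, by simp⟩
    · exact exists_eq_norm_smul hz
  obtain ⟨y, hy⟩ := h3
  have h4 : ‖F x‖ ≤ M * ‖x‖ ^ k := by
    conv_lhs => rw [hy, hk]
    rw [norm_mul, norm_pow, norm_norm, mul_comm]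
    gcongr
    exact hM y
  rw [norm_mul, Real.norm_of_nonneg (Real.exp_pos _).le, ← mul_assoc]
  gcongr

/-- The Gaussian integral of a homogeneous function in polar coordinates. -/
theorem integral_mul_exp_neg_norm_sq (F : Amb n → ℝ) {k : ℕ}
    (hk : ∀ (r : ℝ) (x : Amb n), F (r • x) = r ^ k * F x) :
    ∫ x, F x * Real.exp (-‖x‖ ^ 2) =
      (∫ x : Sph n, F x ∂(surf n)) * (Real.Gamma (((n + k : ℕ) + 1) / 2) / 2) := by
  calc ∫ x, F x * Real.exp (-‖x‖ ^ 2)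
      = ∫ x : ({(0)}ᶜ : Set (Amb n)), F x * Real.exp (-‖(x : Amb n)‖ ^ 2)
          ∂((volume : Measure (Amb n)).comap (↑)) := by
        rw [integral_subtype_comap (measurableSet_singleton _).compl
          fun x => F x * Real.exp (-‖x‖ ^ 2), restrict_compl_singleton]
    _ = ∫ a : Sph n × Ioi (0 : ℝ), F a.1 * ((a.2 : ℝ) ^ k * Real.exp (-(a.2 : ℝ) ^ 2))
          ∂((surf n).prod (.volumeIoiPow n)) := by
        have h := (volume.measurePreserving_homeomorphUnitSphereProd (E := Amb n)).integral_comp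
          (Homeomorph.measurableEmbedding _)
          (fun a => F a.1 * ((a.2 : ℝ) ^ k * Real.exp (-(a.2 : ℝ) ^ 2)))
        simp only [finrank_euclideanSpace, Fintype.card_fin, Nat.add_sub_cancel] at h
        rw [surf, ← h]
        refine integral_congr_ae (ae_of_all _ fun x => ?_)
        have hx : (x : Amb n) ≠ 0 := x.2
        have hxe : F (x : Amb n) = ‖(x : Amb n)‖ ^ k * F (‖(x : Amb n)‖⁻¹ • (x : Amb n)) := by
          rw [← hk, smul_smul, mul_inv_cancel₀ (norm_ne_zero_iff.2 hx), one_smul]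
        simp only [homeomorphUnitSphereProd_apply_snd_coe, homeomorphUnitSphereProd_apply_fst_coe]
        rw [hxe]
        ring
    _ = _ := by
        rw [integral_prod_mul (fun x : Sph n => F x)
          (fun r : Ioi (0 : ℝ) => (r : ℝ) ^ k * Real.exp (-(r : ℝ) ^ 2)),
          integral_volumeIoiPow_pow_mul_exp]

theorem hasFDerivAt_exp_neg_norm_sq (x : Amb n) :
    HasFDerivAt (fun x : Amb n => Real.exp (-‖x‖ ^ 2))
      (Real.exp (-‖x‖ ^ 2) • -(2 • innerSL ℝ x) : Amb n →L[ℝ] ℝ) x :=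
  ((hasStrictFDerivAt_norm_sq x).hasFDerivAt.neg).exp

/-! ### The cubic form of the simplex and its Dirichlet energy -/

/-- The symmetric cubic form attached to the points `q i`. -/
noncomputable def cubic (q : Fin (n + 2) → Sph n) (x : Amb n) : ℝ :=
  ∑ i, ⟪(q i : Amb n), x⟫ ^ 3

variable {q : Fin (n + 2) → Sph n}

theorem contDiff_cubic (q : Fin (n + 2) → Sph n) : ContDiff ℝ ∞ (cubic q) :=
  ContDiff.sum fun _ _ => (contDiff_const.inner ℝ contDiff_id).pow 3

theorem cubic_smul (q : Fin (n + 2) → Sph n) (r : ℝ) (x : Amb n) :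
    cubic q (r • x) = r ^ 3 * cubic q x := by
  simp only [cubic, inner_smul_right, mul_pow, Finset.mul_sum]

theorem hasGradientAt_cubic (q : Fin (n + 2) → Sph n) (x : Amb n) :
    HasGradientAt (cubic q) (∑ i, (3 * ⟪(q i : Amb n), x⟫ ^ 2) • (q i : Amb n)) x := by
  rw [hasGradientAt_iff_hasFDerivAt]
  have h : HasFDerivAt (cubic q)
      (∑ i, (3 * ⟪(q i : Amb n), x⟫ ^ 2) • innerSL ℝ (q i : Amb n)) x := by
    unfold cubic
    refine HasFDerivAt.fun_sum fun i _ => ?_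
    simpa using ((innerSL ℝ (q i : Amb n)).hasFDerivAt (x := x)).pow 3
  convert! h using 1
  ext v
  simp

theorem gradient_cubic (q : Fin (n + 2) → Sph n) (x : Amb n) :
    gradient (cubic q) x = ∑ i, (3 * ⟪(q i : Amb n), x⟫ ^ 2) • (q i : Amb n) :=
  (hasGradientAt_cubic q x).gradient

/-- Euler's identity in degree three; it makes the radial part of the squared gradient equal to `9
P²` on the sphere. -/
theorem inner_gradient_cubic_self (q : Fin (n + 2) → Sph n) (x : Amb n) :
    ⟪gradient (cubic q) x, x⟫ = 3 * cubic q x := by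
  rw [gradient_cubic, sum_inner, cubic, Finset.mul_sum]
  refine Finset.sum_congr rfl fun i _ => ?_
  rw [inner_smul_left]
  simp
  ring

/-- Only one of the two gradient factors is expanded, so that the summands match those produced by
integrating by parts in each direction `q i`. -/
theorem norm_gradient_cubic_sq (q : Fin (n + 2) → Sph n) (x : Amb n) :
    ‖gradient (cubic q) x‖ ^ 2 =
      3 * ∑ i, ⟪(q i : Amb n), x⟫ ^ 2 * ⟪gradient (cubic q) x, (q i : Amb n)⟫ := by
  rw [← real_inner_self_eq_norm_sq]
  conv_lhs => rw [gradient_cubic q x, inner_sum, ← gradient_cubic]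
  rw [Finset.mul_sum]
  refine Finset.sum_congr rfl fun i _ => ?_
  rw [inner_smul_right]
  ring

theorem gradient_cubic_smul (q : Fin (n + 2) → Sph n) (r : ℝ) (x : Amb n) :
    gradient (cubic q) (r • x) = r ^ 2 • gradient (cubic q) x := by
  rw [gradient_cubic, gradient_cubic, Finset.smul_sum]
  refine Finset.sum_congr rfl fun i _ => ?_
  rw [inner_smul_right, smul_smul]
  ring_nf

/-- Each `q i` is orthogonal to the sum, since `1 + (n+1) · (-1/(n+1)) = 0`. This is what makes the
cubic form harmonic. -/
theorem SpreadEvenly.sum_eq_zero (hq : SpreadEvenly q) : ∑ i, (q i : Amb n) = 0 := by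
  have h : ∀ i, ⟪(q i : Amb n), ∑ j, (q j : Amb n)⟫ = 0 := by
    intro i
    rw [inner_sum, ← Finset.add_sum_erase _ _ (Finset.mem_univ i),
      Finset.sum_congr rfl fun j hj => hq i j (Finset.ne_of_mem_erase hj).symm]
    have : (n : ℝ) + 1 ≠ 0 := by positivity
    simp
    field_simp
    ring
  rw [← inner_self_eq_zero (𝕜 := ℝ), sum_inner]
  exact Finset.sum_eq_zero fun i _ => h i

theorem SpreadEvenly.injective (hq : SpreadEvenly q) : Function.Injective q := by
  intro i j hij
  by_contra hne
  have h := hq i j hne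
  rw [hij, inner_sphere_eq] at h
  have : (0 : ℝ) < n + 1 := by positivity
  simp at h
  have h2 : -1 / ((n : ℝ) + 1) < 0 := div_neg_of_neg_of_pos (by norm_num) this
  linarith

/-- The cubic form is invariant under the symmetries of the simplex. -/
theorem isSymmetric_cubic (hq : SpreadEvenly q) : IsSymmetric q fun x => cubic q x := by
  intro φ hφ x
  have h : ∀ i, ∃ j, q j = rotate φ (q i) := fun i => by
    have : rotate φ (q i) ∈ range q := hφ.2 ▸ ⟨q i, ⟨i, rfl⟩, rfl⟩
    exact this
  choose σ hσ using h
  have hσ' : ∀ i, (q (σ i) : Amb n) = φ (q i) := fun i => by rw [hσ]; rfl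
  have hinj : Function.Injective σ := by
    intro i j hij
    apply hq.injective
    have h1 := hσ' i
    rw [hij, hσ' j] at h1
    exact Subtype.ext (φ.injective h1).symm
  have hbij : Function.Bijective σ := Finite.injective_iff_bijective.1 hinj
  change cubic q (φ x) = cubic q x
  unfold cubic
  rw [← hbij.sum_comp fun i => ⟪(q i : Amb n), φ x⟫ ^ 3]
  simp only [hσ', LinearIsometryEquiv.inner_map_map]

/-- The value is `1 + (n+1) · (-1/(n+1))³`, which vanishes for `n = 0`; this is where `1 ≤ n`
enters. -/
theorem cubic_apply_self_pos (hn : 1 ≤ n) (hq : SpreadEvenly q) (i : Fin (n + 2)) :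
    0 < cubic q (q i) := by
  have hm : (1 : ℝ) < (n : ℝ) + 1 := by
    have : (1 : ℝ) ≤ n := by exact_mod_cast hn
    linarith
  have h1 : cubic q (q i) = 1 - 1 / ((n : ℝ) + 1) ^ 2 := by
    rw [cubic, ← Finset.add_sum_erase _ _ (Finset.mem_univ i),
      Finset.sum_congr rfl fun j hj => by rw [hq j i (Finset.ne_of_mem_erase hj)]]
    simp
    field_simp
    ring
  rw [h1, sub_pos, div_lt_one (by positivity)]
  exact one_lt_pow₀ hm two_ne_zero

/-- The form is odd, so its Gaussian integral vanishes, and the radial Gamma factor is positive. -/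
theorem integral_cubic (q : Fin (n + 2) → Sph n) : ∫ x : Sph n, cubic q x ∂(surf n) = 0 := by
  have h := integral_mul_exp_neg_norm_sq (cubic q) (cubic_smul q)
  have h2 : ∫ x, cubic q x * Real.exp (-‖x‖ ^ 2) = 0 := by
    have h3 := integral_neg_eq_self (fun x => cubic q x * Real.exp (-‖x‖ ^ 2)) volume
    have h4 : ∀ x, cubic q (-x) = -cubic q x := fun x => by
      have := cubic_smul q (-1) x
      rw [neg_one_smul] at this
      rw [this]; ring
    simp only [h4, norm_neg, neg_mul, integral_neg] at h3
    linarith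
  rw [h2] at h
  have h5 : 0 < Real.Gamma (((n + 3 : ℕ) + 1) / 2) / 2 :=
    div_pos (Real.Gamma_pos_of_pos (by positivity)) two_pos
  exact (mul_eq_zero.1 h.symm).resolve_right h5.ne'

theorem integral_cubic_sq_pos (hn : 1 ≤ n) (hq : SpreadEvenly q) :
    0 < ∫ x : Sph n, cubic q x ^ 2 ∂(surf n) := by
  have hc : Continuous fun x : Sph n => cubic q x ^ 2 :=
    ((contDiff_cubic q).continuous.comp continuous_subtype_val).pow 2
  exact hc.integral_pos_of_hasCompactSupport_nonneg_nonzero (HasCompactSupport.of_compactSpace _)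
    (fun x => sq_nonneg _) (x := q 0) (pow_pos (cubic_apply_self_pos hn hq 0) 2).ne'

/-- Gaussian integration by parts for the cubic form. -/
theorem integral_norm_gradient_cubic_sq_mul_exp (hq : SpreadEvenly q) :
    ∫ x, ‖gradient (cubic q) x‖ ^ 2 * Real.exp (-‖x‖ ^ 2) =
      6 * ∫ x, cubic q x ^ 2 * Real.exp (-‖x‖ ^ 2) := by
  have hP := (contDiff_cubic q).continuous
  have hG := (contDiff_cubic q).contDiff_gradient.continuous
  have hI1 : ∀ i, Integrable fun x => ⟪(q i : Amb n), x⟫ ^ 3 * cubic q x * Real.exp (-‖x‖ ^ 2) :=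
    fun i => integrable_mul_exp_neg_norm_sq (k := 6) (by fun_prop) fun r x => by
      rw [cubic_smul, inner_smul_right]; ring
  have hI2 : ∀ i, Integrable fun x => ⟪(q i : Amb n), x⟫ * cubic q x * Real.exp (-‖x‖ ^ 2) :=
    fun i => integrable_mul_exp_neg_norm_sq (k := 4) (by fun_prop) fun r x => by
      rw [cubic_smul, inner_smul_right]; ring
  have hI3 : ∀ i, Integrable fun x => ⟪(q i : Amb n), x⟫ ^ 2 *
      ⟪gradient (cubic q) x, (q i : Amb n)⟫ * Real.exp (-‖x‖ ^ 2) :=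
    fun i => integrable_mul_exp_neg_norm_sq (k := 4) (by fun_prop) fun r x => by
      rw [gradient_cubic_smul, inner_smul_right, inner_smul_left]; simp; ring
  have hI4 : ∀ i, Integrable fun x => ⟪(q i : Amb n), x⟫ ^ 2 * cubic q x * Real.exp (-‖x‖ ^ 2) :=
    fun i => integrable_mul_exp_neg_norm_sq (k := 5) (by fun_prop) fun r x => by
      rw [cubic_smul, inner_smul_right]; ring
  -- Integration by parts of `⟪q i, x⟫² P` against the Gaussian in the unit direction `q i`. Summed
  -- over `i`, the first term on the right drops out because `∑ q i = 0`.
  have key : ∀ i, 2 * ∫ x, ⟪(q i : Amb n), x⟫ ^ 3 * cubic q x * Real.exp (-‖x‖ ^ 2) =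
      2 * (∫ x, ⟪(q i : Amb n), x⟫ * cubic q x * Real.exp (-‖x‖ ^ 2)) +
        ∫ x, ⟪(q i : Amb n), x⟫ ^ 2 * ⟪gradient (cubic q) x, (q i : Amb n)⟫ *
          Real.exp (-‖x‖ ^ 2) := by
    intro i
    have hA : ∀ x, HasFDerivAt (fun x => ⟪(q i : Amb n), x⟫ ^ 2 * cubic q x)
        (⟪(q i : Amb n), x⟫ ^ 2 • fderiv ℝ (cubic q) x +
          cubic q x • ((2 * ⟪(q i : Amb n), x⟫) • innerSL ℝ (q i : Amb n))) x := by
      intro x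
      have h1 : HasFDerivAt (fun x => ⟪(q i : Amb n), x⟫ ^ 2)
          ((2 * ⟪(q i : Amb n), x⟫) • innerSL ℝ (q i : Amb n)) x := by
        simpa using ((innerSL ℝ (q i : Amb n)).hasFDerivAt (x := x)).pow 2
      exact h1.mul (((contDiff_cubic q).differentiable (by simp)) x).hasFDerivAt
    have e1 : (fun x => fderiv ℝ (fun x => ⟪(q i : Amb n), x⟫ ^ 2 * cubic q x) x (q i : Amb n) *
        Real.exp (-‖x‖ ^ 2)) = fun x => 2 * (⟪(q i : Amb n), x⟫ * cubic q x * Real.exp (-‖x‖ ^ 2)) +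
          ⟪(q i : Amb n), x⟫ ^ 2 * ⟪gradient (cubic q) x, (q i : Amb n)⟫ *
            Real.exp (-‖x‖ ^ 2) := by
      ext x
      rw [(hA x).fderiv, inner_gradient_left]
      simp
      ring
    have e2 : (fun x => (⟪(q i : Amb n), x⟫ ^ 2 * cubic q x) *
        fderiv ℝ (fun x : Amb n => Real.exp (-‖x‖ ^ 2)) x (q i : Amb n)) =
        fun x => -2 * (⟪(q i : Amb n), x⟫ ^ 3 * cubic q x * Real.exp (-‖x‖ ^ 2)) := by
      ext x
      rw [(hasFDerivAt_exp_neg_norm_sq x).fderiv]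
      simp [real_inner_comm]
      ring
    have h := integral_mul_fderiv_eq_neg_fderiv_mul_of_integrable (μ := volume)
      (f := fun x => ⟪(q i : Amb n), x⟫ ^ 2 * cubic q x)
      (g := fun x : Amb n => Real.exp (-‖x‖ ^ 2)) (v := (q i : Amb n))
      (by rw [e1]; exact ((hI2 i).const_mul 2).add (hI3 i))
      (by rw [e2]; exact (hI1 i).const_mul (-2)) (hI4 i)
      (fun x _ => (hA x).differentiableAt)
      (fun x _ => (hasFDerivAt_exp_neg_norm_sq x).differentiableAt)
    rw [e1, e2, integral_const_mul, integral_add ((hI2 i).const_mul 2) (hI3 i),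
      integral_const_mul] at h
    linarith
  have s1 : ∫ x, cubic q x ^ 2 * Real.exp (-‖x‖ ^ 2) =
      ∑ i, ∫ x, ⟪(q i : Amb n), x⟫ ^ 3 * cubic q x * Real.exp (-‖x‖ ^ 2) := by
    rw [← integral_finsetSum _ fun i _ => hI1 i]
    refine integral_congr_ae (ae_of_all _ fun x => ?_)
    simp only
    rw [← Finset.sum_mul, ← Finset.sum_mul, ← cubic, pow_two]
  have s2 : ∑ i, ∫ x, ⟪(q i : Amb n), x⟫ * cubic q x * Real.exp (-‖x‖ ^ 2) = 0 := by
    rw [← integral_finsetSum _ fun i _ => hI2 i, ← integral_zero (Amb n) ℝ]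
    refine integral_congr_ae (ae_of_all _ fun x => ?_)
    simp only
    rw [← Finset.sum_mul, ← Finset.sum_mul, ← sum_inner, hq.sum_eq_zero, inner_zero_left]
    simp
  have s3 : ∫ x, ‖gradient (cubic q) x‖ ^ 2 * Real.exp (-‖x‖ ^ 2) =
      3 * ∑ i, ∫ x, ⟪(q i : Amb n), x⟫ ^ 2 * ⟪gradient (cubic q) x, (q i : Amb n)⟫ *
          Real.exp (-‖x‖ ^ 2) := by
    rw [← integral_finsetSum _ fun i _ => hI3 i, ← integral_const_mul]
    refine integral_congr_ae (ae_of_all _ fun x => ?_)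
    simp only
    rw [← Finset.sum_mul, norm_gradient_cubic_sq, mul_assoc]
  have h := Finset.sum_congr (rfl : (Finset.univ : Finset (Fin (n + 2))) = _) fun i _ => key i
  rw [← Finset.mul_sum, Finset.sum_add_distrib, ← Finset.mul_sum, s2, ← s1] at h
  rw [s3]
  linarith

/-- The cubic form restricts to an eigenfunction of degree three on the sphere. -/
theorem integral_norm_tangentialGradient_cubic_sq (hq : SpreadEvenly q) :
    ∫ x : Sph n, ‖tangentialGradient (cubic q) x‖ ^ 2 ∂(surf n) =
      (3 * n + 6) * ∫ x : Sph n, cubic q x ^ 2 ∂(surf n) := by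
  have hP : Continuous fun x : Sph n => cubic q x :=
    (contDiff_cubic q).continuous.comp continuous_subtype_val
  have hG : Continuous fun x : Sph n => gradient (cubic q) (x : Amb n) :=
    (contDiff_cubic q).contDiff_gradient.continuous.comp continuous_subtype_val
  have h := integral_norm_gradient_cubic_sq_mul_exp hq
  rw [integral_mul_exp_neg_norm_sq (fun x => ‖gradient (cubic q) x‖ ^ 2) (k := 4)
      fun r x => by rw [gradient_cubic_smul, norm_smul, mul_pow, Real.norm_eq_abs, sq_abs]; ring,
    integral_mul_exp_neg_norm_sq (fun x => cubic q x ^ 2) (k := 6)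
      fun r x => by rw [cubic_smul]; ring] at h
  -- The integrands have degrees `4` and `6`; their radial factors differ by `(n+5)/2`. Hence `6
  -- (n+5)/2 = 3n + 15`, and removing the radial part `9` leaves `3n + 6`.
  have hΓ : Real.Gamma (((n + 6 : ℕ) + 1) / 2) =
      ((n : ℝ) + 5) / 2 * Real.Gamma (((n + 4 : ℕ) + 1) / 2) := by
    have h1 : (((n + 4 : ℕ) + 1) / 2 : ℝ) = ((n : ℝ) + 5) / 2 := by push_cast; ring
    have h2 : (((n + 6 : ℕ) + 1) / 2 : ℝ) = ((n : ℝ) + 5) / 2 + 1 := by push_cast; ring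
    rw [h1, h2, Real.Gamma_add_one (by positivity)]
  have hΓ0 : 0 < Real.Gamma (((n + 4 : ℕ) + 1) / 2) := Real.Gamma_pos_of_pos (by positivity)
  rw [hΓ] at h
  have h3 : ∫ x : Sph n, ‖gradient (cubic q) (x : Amb n)‖ ^ 2 ∂(surf n) =
      (3 * n + 15) * ∫ x : Sph n, cubic q x ^ 2 ∂(surf n) := by
    refine mul_right_cancel₀ hΓ0.ne' ?_
    linarith
  simp_rw [norm_tangentialGradient_sq, inner_gradient_cubic_self, mul_pow]
  rw [integral_sub (integrable_surf (by fun_prop)) (integrable_surf (by fun_prop)),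
    integral_const_mul, h3]
  ring

/-- Allows the cubic form to be replaced by a compactly supported cutoff that agrees with it near
the sphere. -/
theorem tangentialGradient_congr {f g : Amb n → ℝ} {x : Amb n} (h : f =ᶠ[𝓝 x] g) :
    tangentialGradient f x = tangentialGradient g x := by
  rw [tangentialGradient, tangentialGradient, h.gradient_eq]

/-- The constant function is unstable in the direction of the cubic form. -/
theorem exists_hasSecondVariation_cubic_neg (hn : 1 ≤ n) {p : ℝ} (hp : p < -2 * (n : ℝ) - 5)
    (hq : SpreadEvenly q) :
    ∃ s < 0, HasSecondVariation p (fun _ => 1) (fun x : Sph n => cubic q x) s := by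
  have hp0 : p ≠ 0 := by
    have : (0 : ℝ) ≤ n := by positivity
    linarith
  obtain ⟨f, hf, hc, hfe⟩ := (contDiff_cubic q).exists_hasCompactSupport_eventuallyEq
  have hfx : ∀ x : Sph n, f x = cubic q x := fun x => (hfe x).self_of_nhds
  obtain ⟨Q, hQ, h0, h1, h2⟩ := exists_polynomial_energy_variation p hf hc
  have hmean : ∫ x : Sph n, f x ∂(surf n) = 0 := by simp_rw [hfx]; exact integral_cubic q
  have h := hasSecondVariation_one hp0 hf hQ h0 h1 hmean
  simp_rw [hfx, tangentialGradient_congr (hfe _)] at h h2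
  refine ⟨_, ?_, h⟩
  rw [integral_norm_tangentialGradient_cubic_sq hq] at h2
  have hS := integral_cubic_sq_pos hn hq
  have hpos : 0 < 2 * Q.coeff 2 - (p - 1) * ∫ x : Sph n, cubic q x ^ 2 ∂(surf n) := by
    -- The threshold for `p` appears here: `n - (3n + 6) - (p - 1) = -2n - 5 - p`.
    nlinarith [mul_pos (by linarith : 0 < -2 * (n : ℝ) - 5 - p) hS]
  have : (0 : ℝ) < n + 1 := by positivity
  nlinarith [mul_pos this hpos]

end

/-! ### Strict decrease and conclusion -/

/-- A function with a critical point and negative second derivative there decreases strictly to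
the right. -/
theorem eventually_lt_of_second_deriv_neg {E g : ℝ → ℝ} {s : ℝ} (hs : s < 0)
    (hE : ∀ᶠ ε in 𝓝 (0 : ℝ), HasDerivAt E (g ε) ε) (hg : HasDerivAt g s 0) (h0 : g 0 = 0) :
    ∀ᶠ ε in 𝓝[>] (0 : ℝ), E ε < E 0 := by
  have h1 : ∀ᶠ ε in 𝓝[>] (0 : ℝ), g ε < 0 := by
    have h2 := (hasDerivAt_iff_tendsto_slope.1 hg).mono_left
      (nhdsWithin_mono (0 : ℝ) fun x (hx : 0 < x) => hx.ne')
    filter_upwards [h2.eventually (gt_mem_nhds hs), self_mem_nhdsWithin] with ε h3 (h4 : 0 < ε)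
    rw [slope_def_field, h0, sub_zero, sub_zero] at h3
    exact (div_neg_iff.1 h3).elim (fun h => absurd h.2 h4.not_gt) fun h => h.1
  obtain ⟨δ, hδ, hball⟩ := Metric.eventually_nhds_iff.1 hE
  obtain ⟨η, hη, hη'⟩ := mem_nhdsGT_iff_exists_Ioo_subset.1 h1
  filter_upwards [Ioo_mem_nhdsGT (lt_min hδ hη)] with ε hε
  have hεδ : ε < δ := hε.2.trans_le (min_le_left _ _)
  have hεη : ε < η := hε.2.trans_le (min_le_right _ _)
  have hd : ∀ t ∈ Icc 0 ε, HasDerivAt E (g t) t := fun t ht => hball (by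
    rw [Real.dist_eq, sub_zero, abs_of_nonneg ht.1]; exact ht.2.trans_lt hεδ)
  refine strictAntiOn_of_deriv_neg (convex_Icc 0 ε)
    (fun t ht => (hd t ht).continuousAt.continuousWithinAt) (fun t ht => ?_)
    (left_mem_Icc.2 hε.1.le) (right_mem_Icc.2 hε.1.le) hε.1
  rw [interior_Icc] at ht
  rw [(hd t (Ioo_subset_Icc_self ht)).deriv]
  exact hη' ⟨ht.1, ht.2.trans hεη⟩

theorem theorem7p1 (n : ℕ) (hn : 1 ≤ n) (p : ℝ) (hp : p < -2 * (n : ℝ) - 5)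
    (q : Fin (n + 2) → Sph n) (hq : SpreadEvenly q) :
    (∀ ξ : Sph n → ℝ, IsSmooth ξ → IsSymmetric q ξ → IsAdmissible p q (fun _ => 1) ξ) ∧
    IsCriticalPoint p q (fun _ => 1) ∧
    IsUnstable p q (fun _ => 1) ∧
    (∃ v ∈ classB p q, IsSmooth v ∧ energy v < energy (fun _ : Sph n => 1)) := by
  have hp0 : p ≠ 0 := by
    have : (0 : ℝ) ≤ n := by positivity
    linarith
  have hcrit := isCriticalPoint_one hp0 q
  have hadm : IsAdmissible p q (fun _ => 1) fun x => cubic q x :=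
    isAdmissible_one hp0 (IsSmooth.of_contDiff (contDiff_cubic q)) (isSymmetric_cubic hq)
  obtain ⟨s, hs, hsec⟩ := exists_hasSecondVariation_cubic_neg hn hp hq
  refine ⟨fun ξ => isAdmissible_one hp0, hcrit, ⟨_, hadm, s, hs, hsec⟩, ?_⟩
  obtain ⟨g, hE, hg⟩ := hsec
  -- The derivative function supplied by the second variation vanishes at `0` by criticality and
  -- uniqueness of derivatives.
  have hg0 : g 0 = 0 := hE.self_of_nhds.unique (hcrit.2 _ hadm)
  obtain ⟨ε, hε, hεB⟩ := ((eventually_lt_of_second_deriv_neg hs hE hg hg0).and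
    (nhdsWithin_le_nhds hadm.2.2)).exists
  refine ⟨_, hεB, ?_, ?_⟩
  · rw [variation_one_eq]
    exact IsSmooth.of_contDiff (f := fun x => _ * (1 + ε * cubic q x))
      (contDiff_const.mul (contDiff_const.add (contDiff_const.mul (contDiff_cubic q))))
  · have h1 : variation p (fun _ => 1) (fun x : Sph n => cubic q x) 0 = fun _ => 1 := by
      rw [variation_one_eq]
      have := (Real.rpow_pos_of_pos (surf_real_univ_pos (n := n)) (1 / p)).ne'
      simp only [zero_mul, add_zero, Real.one_rpow, integral_const, smul_eq_mul, mul_one,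
        div_self this]
    rwa [h1] at hε
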